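/- Let $\mathbb{K}$ be a field of characteristic zero, $G$ an abelian group (written multiplicatively, with identity $e$), and $\chi:G\times G\to\mathbb{K}^\times$ a bicharacter. Let $A=\bigoplus_{g\in G}A_g$ be a color Hopf algebra, i.e. a $G$-graded $\mathbb{K}$-algebra that is also a graded coalgebra $(A,\Delta,\epsilon)$, such that $\epsilon:A\to\mathbb{K}$ is an algebra map, $\Delta:A\to(A\otimes A)^\chi$ is an algebra map, where $(a\otimes b)*(a'\otimes b')=\chi(|b|,|a'|)\,aa'\otimes bb'$ for homogeneous elements, and there is a bijective graded linear map $S:A\to A$ with $\sum a_1S(a_2)=\epsilon(a)1=\sum S(a_1)a_2$. Let $M=\bigoplus_g M_g$ be a graded $A$-bimodule, equivalently a graded left module over $A^e=A\otimes A^{op}$ (with $A^e_g=\sum_h A_h\otimes A_{h^{-1}g}$). For a graded algebra $B$ (here $B=A$ or $B=A^e$), write $B\text{-gr}$ for the category of graded left $B$-modules with the degree-preserving $B$-linear maps, $N[h]$ for the shift $N[h]_g=N_{hg}$, $\mathrm{HOM}_B(X,Y)_h=\{f\in\mathrm{Hom}_B(X,Y) : f(X_g)\subseteq Y_{gh}\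 \forall g\}$, and let $\mathrm{Ext}^n_{B\text{-gr}}(X,-)$ and $\mathrm{EXT}^n_B(X,-)_h$ be the $n$-th right derived functors on $B\text{-gr}$ of $\mathrm{Hom}_{B\text{-gr}}(X,-)$ and $\mathrm{HOM}_B(X,-)_h$. Put $\mathrm{HH}^n(A,M)_h=\mathrm{EXT}^n_{A^e}(A,M)_h$. Let $\mathbb{K}$ be the trivial graded $A$-module (concentrated in degree $e$, with action through $\epsilon$), and for a graded bimodule $N$ let ${}^{ad}N$ be the graded space $N$ with the $A$-action $a\cdot m=\sum\chi(|a_2|,|m|)\,a_1.m.S(a_2)$, where $|m|$ is the degree of $m$ in $N$. Then for every $h\in G$ and every $n\ge 0$ there are isomorphisms of $\mathbb{K}$-vector spaces $$\mathrm{HH}^n(A,M)_h\;\cong\;\mathrm{Ext}^n_{A\text{-gr}}\bigl(\mathbb{K},{}^{ad}(M[h])\bigr)\;\cong\;\mathrm{EXT}^n_A\bigl(\mathbb{K},({}^{ad}(M[h]))[h^{-1}]\bigr)_h .$$ Here $({}^{ad}(M[h]))[h^{-1}]$ is the graded space $M$ with the adjoint action in which $|m|$ is replaced by the degree $h^{-1}|m|$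 of $m$ in $M[h]$. If $\chi(g,h)=1$ for all $g\in G$ (in particular if $h=e$), then moreover $\mathrm{Ext}^n_{A\text{-gr}}(\mathbb{K},{}^{ad}(M[h]))\cong\mathrm{EXT}^n_A(\mathbb{K},{}^{ad}M)_h$. -/

import Mathlib

universe u

noncomputable section

namespace ColorHopf

open CategoryTheory CategoryTheory.Limits
open scoped TensorProduct DirectSum

set_option linter.unusedSectionVars false

/-! ### Direct sum decompositions of vector spaces -/

section Decomp

variable {K : Type u} [Field K] {G : Type u} [DecidableEq G]
variable {M : Type u} [AddCommGroup M] [Module K M] {ℳ : G → Submodule K M}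
variable {P : Type u} [AddCommGroup P] [Module K P]

/-- For `M = ⨁ M_g` and linear maps `f g : M → P`, the linear map whose restriction to `M_g`
is `f g`. -/
def byDegree (hM : DirectSum.IsInternal ℳ) (f : G → M →ₗ[K] P) : M →ₗ[K] P :=
  DirectSum.toModule K G P (fun g => f g ∘ₗ (ℳ g).subtype) ∘ₗ
    (LinearEquiv.ofBijective (DirectSum.coeLinearMap ℳ) hM).symm.toLinearMap

theorem byDegree_of_mem (hM : DirectSum.IsInternal ℳ) (f : G → M →ₗ[K] P) {g : G} {m : M}
    (hm : m ∈ ℳ g) : byDegree hM f m = f g m := by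
  have : (LinearEquiv.ofBijective (DirectSum.coeLinearMap ℳ) hM).symm m
      = DirectSum.lof K G (fun g => ℳ g) g ⟨m, hm⟩ := by
    rw [LinearEquiv.symm_apply_eq]
    exact (DirectSum.coeLinearMap_lof ℳ g ⟨m, hm⟩).symm
  rw [byDegree, LinearMap.comp_apply, LinearEquiv.coe_coe, this, DirectSum.toModule_lof]
  rfl

theorem internal_induction (hM : DirectSum.IsInternal ℳ) {motive : M → Prop}
    (hom : ∀ g, ∀ m ∈ ℳ g, motive m) (zero : motive 0)
    (add : ∀ x y, motive x → motive y → motive (x + y)) (m : M) : motive m := by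
  have h : m ∈ ⨆ g, ℳ g := by rw [hM.submodule_iSup_eq_top]; trivial
  exact Submodule.iSup_induction ℳ (motive := motive) h hom zero add

theorem hom_ext_of_internal (hM : DirectSum.IsInternal ℳ) {f f' : M →ₗ[K] P}
    (h : ∀ g, ∀ m ∈ ℳ g, f m = f' m) : f = f' := by
  ext m
  induction m using internal_induction hM with
  | hom g m hm => exact h g m hm
  | zero => simp
  | add x y hx hy => simp [hx, hy]

theorem isInternal_of_proj (htop : ∀ m : M, m ∈ ⨆ g, ℳ g) (p : G → M →ₗ[K] M)
    (same : ∀ g, ∀ m ∈ ℳ g, p g m = m)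
    (ne : ∀ g h, g ≠ h → ∀ m ∈ ℳ h, p g m = 0) : DirectSum.IsInternal ℳ := by
  rw [DirectSum.isInternal_submodule_iff_iSupIndep_and_iSup_eq_top]
  refine ⟨?_, eq_top_iff.2 fun m _ => htop m⟩
  intro g
  rw [Submodule.disjoint_def]
  intro x hx hx'
  have h2 : (⨆ j, ⨆ (_ : j ≠ g), ℳ j) ≤ LinearMap.ker (p g) :=
    iSup₂_le fun j hj m hm => ne g j hj.symm m hm
  rw [← same g x hx]
  exact h2 hx'

/-- The projection of `M = ⨁ M_g` onto `M_g`. -/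
def component (hM : DirectSum.IsInternal ℳ) (g : G) : M →ₗ[K] M :=
  byDegree hM (Pi.single g LinearMap.id)

theorem component_same (hM : DirectSum.IsInternal ℳ) {g : G} {m : M} (hm : m ∈ ℳ g) :
    component hM g m = m := by
  simp [component, byDegree_of_mem hM _ hm]

theorem component_ne (hM : DirectSum.IsInternal ℳ) {g h : G} (hgh : g ≠ h) {m : M}
    (hm : m ∈ ℳ h) : component hM g m = 0 := by
  rw [component, byDegree_of_mem hM _ hm, Pi.single_eq_of_ne hgh.symm, LinearMap.zero_apply]

theorem component_mem (hM : DirectSum.IsInternal ℳ) (g : G) (m : M) :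
    component hM g m ∈ ℳ g := by
  induction m using internal_induction hM with
  | hom h m hm =>
    by_cases hgh : g = h
    · subst hgh; rw [component_same hM hm]; exact hm
    · rw [component_ne hM hgh hm]; exact zero_mem _
  | zero => simp
  | add x y hx hy => rw [map_add]; exact add_mem hx hy

theorem exists_sum_component (hM : DirectSum.IsInternal ℳ) (m : M) :
    ∃ s : Finset G, ∀ t, s ⊆ t → ∑ g ∈ t, component hM g m = m := by
  induction m using internal_induction hM with
  | hom g m hm =>
    refine ⟨{g}, fun t ht => ?_⟩
    rw [Finset.sum_eq_single_of_mem g (ht (by simp))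
      (fun b _ hb => component_ne hM hb hm), component_same hM hm]
  | zero => exact ⟨∅, by simp⟩
  | add x y hx hy =>
    obtain ⟨s, hs⟩ := hx
    obtain ⟨s', hs'⟩ := hy
    refine ⟨s ∪ s', fun t ht => ?_⟩
    simp only [map_add, Finset.sum_add_distrib]
    rw [hs t (Finset.union_subset_left ht), hs' t (Finset.union_subset_right ht)]

/-- A graded linear map commutes with the projections. -/
theorem map_component {ℒ : G → Submodule K P} (hM : DirectSum.IsInternal ℳ)
    (hP : DirectSum.IsInternal ℒ) (f : M →ₗ[K] P) (hf : ∀ g, ∀ m ∈ ℳ g, f m ∈ ℒ g)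
    (g : G) (m : M) : f (component hM g m) = component hP g (f m) := by
  induction m using internal_induction hM with
  | hom h m hm =>
    by_cases hgh : g = h
    · subst hgh; rw [component_same hM hm, component_same hP (hf _ _ hm)]
    · rw [component_ne hM hgh hm, component_ne hP hgh (hf _ _ hm), map_zero]
  | zero => simp
  | add x y hx hy => simp [hx, hy]

theorem mem_of_component (hM : DirectSum.IsInternal ℳ) {g : G} {m : M}
    (h : ∀ k, k ≠ g → component hM k m = 0) : m ∈ ℳ g := by
  obtain ⟨s, hs⟩ := exists_sum_component hM m
  have := hs (insert g s) (Finset.subset_insert _ _)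
  rw [Finset.sum_eq_single_of_mem g (by simp) (fun b _ hb => h b hb)] at this
  rw [← this]
  exact component_mem hM g m

end Decomp

/-! ### Graded modules -/

section GrMod

variable {K : Type u} [Field K] {G : Type u} [AddCommGroup G] [DecidableEq G]
variable {A : Type u} [Ring A] [Algebra K A]

/-- A graded left `A`-module: a left `A`-module `M = ⨁ M_g` with `A_g M_h ⊆ M_{g+h}`
(the group `G` is written additively). -/
structure GrMod (𝒜 : G → Submodule K A) where
  /-- the underlying set -/
  carrier : Type u
  [addCommGroup : AddCommGroup carrier]
  [moduleK : Module K carrier]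
  [module : Module A carrier]
  [isScalarTower : IsScalarTower K A carrier]
  /-- the homogeneous components -/
  gr : G → Submodule K carrier
  internal : DirectSum.IsInternal gr
  smul_mem : ∀ {g h : G} {a : A} {m : carrier}, a ∈ 𝒜 g → m ∈ gr h → a • m ∈ gr (g + h)

attribute [instance] GrMod.addCommGroup GrMod.moduleK GrMod.module GrMod.isScalarTower

variable {𝒜 : G → Submodule K A}

namespace GrMod

/-- `Hom_{A-gr}(M, N)`: the `A`-linear maps `f` with `f(M_g) ⊆ N_g` for all `g`. -/
def grHom (M N : GrMod 𝒜) : Submodule K (M.carrier →ₗ[A] N.carrier) where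
  carrier := {f | ∀ g, ∀ m ∈ M.gr g, f m ∈ N.gr g}
  add_mem' hf hf' g m hm := add_mem (hf g m hm) (hf' g m hm)
  zero_mem' _ _ _ := zero_mem _
  smul_mem' c _ hf g m hm := Submodule.smul_mem _ c (hf g m hm)

/-- `HOM_A(M, N)_h`: the `A`-linear maps `f` with `f(M_g) ⊆ N_{g+h}` for all `g`. -/
def homDeg (h : G) (M N : GrMod 𝒜) : Submodule K (M.carrier →ₗ[A] N.carrier) where
  carrier := {f | ∀ g, ∀ m ∈ M.gr g, f m ∈ N.gr (g + h)}
  add_mem' hf hf' g m hm := add_mem (hf g m hm) (hf' g m hm)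
  zero_mem' _ _ _ := zero_mem _
  smul_mem' c _ hf g m hm := Submodule.smul_mem _ c (hf g m hm)

/-- The category `A`-gr of graded left `A`-modules. -/
instance : Category (GrMod 𝒜) where
  Hom M N := grHom M N
  id M := ⟨LinearMap.id, fun _ _ hm => hm⟩
  comp f f' := ⟨f'.1 ∘ₗ f.1, fun g m hm => f'.2 g _ (f.2 g m hm)⟩

/-- The `A`-linear map underlying a morphism of graded modules. -/
def lin {M N : GrMod 𝒜} (f : M ⟶ N) : M.carrier →ₗ[A] N.carrier :=
  Subtype.val (p := fun f => f ∈ grHom M N) f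

/-- A graded `A`-linear map as a morphism. -/
def mkHom {M N : GrMod 𝒜} (f : M.carrier →ₗ[A] N.carrier)
    (hf : ∀ g, ∀ m ∈ M.gr g, f m ∈ N.gr g) : M ⟶ N :=
  (⟨f, hf⟩ : grHom M N)

theorem lin_mem {M N : GrMod 𝒜} (f : M ⟶ N) {g : G} {m : M.carrier} (hm : m ∈ M.gr g) :
    lin f m ∈ N.gr g :=
  Subtype.property (p := fun f => f ∈ grHom M N) f g m hm

@[simp] theorem lin_mkHom {M N : GrMod 𝒜} (f : M.carrier →ₗ[A] N.carrier)
    (hf : ∀ g, ∀ m ∈ M.gr g, f m ∈ N.gr g) : lin (mkHom f hf) = f := rfl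

@[ext] theorem hom_ext {M N : GrMod 𝒜} {f f' : M ⟶ N} (h : ∀ m, lin f m = lin f' m) : f = f' :=
  Subtype.ext (LinearMap.ext h)

@[simp] theorem lin_id (M : GrMod 𝒜) : lin (𝟙 M) = LinearMap.id := rfl

@[simp] theorem lin_comp {M N P : GrMod 𝒜} (f : M ⟶ N) (f' : N ⟶ P) :
    lin (f ≫ f') = lin f' ∘ₗ lin f := rfl

instance : Preadditive (GrMod 𝒜) where
  homGroup M N := inferInstanceAs (AddCommGroup (grHom M N))
  add_comp M N P f f' k := by
    apply hom_ext; intro m; exact map_add (lin k) (lin f m) (lin f' m)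
  comp_add M N P f k k' := rfl

instance : Linear K (GrMod 𝒜) where
  homModule M N := inferInstanceAs (Module K (grHom M N))
  smul_comp M N P c f k := by
    apply hom_ext; intro m; exact LinearMap.map_smul_of_tower (lin k) c (lin f m)
  comp_smul M N P f c k := rfl

@[simp] theorem lin_zero (M N : GrMod 𝒜) : lin (0 : M ⟶ N) = 0 := rfl

@[simp] theorem lin_add {M N : GrMod 𝒜} (f f' : M ⟶ N) : lin (f + f') = lin f + lin f' := rfl

@[simp] theorem lin_sub {M N : GrMod 𝒜} (f f' : M ⟶ N) : lin (f - f') = lin f - lin f' := rfl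

theorem lin_component {M N : GrMod 𝒜} (f : M ⟶ N) (g : G) (m : M.carrier) :
    lin f (component M.internal g m) = component N.internal g (lin f m) :=
  map_component M.internal N.internal ((lin f).restrictScalars K)
    (fun _ _ hm => lin_mem f hm) g m

/-! Kernels, cokernels and finite products of graded modules. -/

/-- The kernel of a morphism, graded by the intersections with the components. -/
def kerObj {M N : GrMod 𝒜} (f : M ⟶ N) : GrMod 𝒜 where
  carrier := LinearMap.ker (lin f)
  gr g := (M.gr g).comap ((LinearMap.ker (lin f)).subtype.restrictScalars K)
  internal := by
    have key : ∀ (g : G) (x : M.carrier), x ∈ (LinearMap.ker (lin f)).restrictScalars K →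
        component M.internal g x ∈ (LinearMap.ker (lin f)).restrictScalars K := by
      intro g x hx
      have hx' : lin f x = 0 := hx
      change lin f _ = 0
      rw [lin_component, hx', map_zero]
    refine isInternal_of_proj (fun x => ?_)
      (fun g => (component M.internal g).restrict (key g)) ?_ ?_
    · obtain ⟨s, hs⟩ := exists_sum_component M.internal x.1
      have : x = ∑ g ∈ s, (component M.internal g).restrict (key g) x := by
        apply Subtype.ext
        rw [← hs s (Finset.Subset.refl _)]
        simp only [AddSubmonoidClass.coe_finsetSum]
        rfl
      rw [this]
      refine Submodule.sum_mem _ fun g _ => Submodule.mem_iSup_of_mem g ?_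
      exact component_mem M.internal g x.1
    · intro g m hm
      exact Subtype.ext (component_same M.internal hm)
    · intro g h hgh m hm
      exact Subtype.ext (component_ne M.internal hgh hm)
  smul_mem ha hm := M.smul_mem ha hm

/-- The inclusion of the kernel. -/
def kerι {M N : GrMod 𝒜} (f : M ⟶ N) : kerObj f ⟶ M :=
  mkHom (LinearMap.ker (lin f)).subtype (fun _ _ hm => hm)

theorem kerι_comp {M N : GrMod 𝒜} (f : M ⟶ N) : kerι f ≫ f = 0 := by
  ext m; exact m.2

/-- The cokernel of a morphism, graded by the images of the components. -/
def cokerObj {M N : GrMod 𝒜} (f : M ⟶ N) : GrMod 𝒜 where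
  carrier := N.carrier ⧸ LinearMap.range (lin f)
  gr g := (N.gr g).map ((LinearMap.range (lin f)).mkQ.restrictScalars K)
  internal := by
    have key : ∀ g : G, (LinearMap.range (lin f)).restrictScalars K ≤
        LinearMap.ker (((LinearMap.range (lin f)).mkQ.restrictScalars K) ∘ₗ
          component N.internal g) := by
      rintro g _ ⟨x, rfl⟩
      change (LinearMap.range (lin f)).mkQ _ = 0
      rw [← lin_component, Submodule.mkQ_apply, Submodule.Quotient.mk_eq_zero]
      exact ⟨_, rfl⟩
    refine isInternal_of_proj (fun x => ?_)
      (fun g => Submodule.liftQ ((LinearMap.range (lin f)).restrictScalars K) _ (key g)) ?_ ?_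
    · obtain ⟨y, rfl⟩ := Submodule.mkQ_surjective _ x
      obtain ⟨s, hs⟩ := exists_sum_component N.internal y
      rw [← hs s (Finset.Subset.refl _), map_sum]
      refine Submodule.sum_mem _ fun g _ => Submodule.mem_iSup_of_mem g ?_
      exact ⟨_, component_mem N.internal g y, rfl⟩
    · rintro g _ ⟨y, hy, rfl⟩
      change (LinearMap.range (lin f)).mkQ (component N.internal g y) = _
      rw [component_same N.internal hy]; rfl
    · rintro g h hgh _ ⟨y, hy, rfl⟩
      change (LinearMap.range (lin f)).mkQ (component N.internal g y) = _
      rw [component_ne N.internal hgh hy, map_zero]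
  smul_mem := by
    rintro g h a _ ha ⟨y, hy, rfl⟩
    exact ⟨a • y, N.smul_mem ha hy, rfl⟩

/-- The projection to the cokernel. -/
def cokerπ {M N : GrMod 𝒜} (f : M ⟶ N) : N ⟶ cokerObj f :=
  mkHom (LinearMap.range (lin f)).mkQ (fun _ _ hm => ⟨_, hm, rfl⟩)

theorem comp_cokerπ {M N : GrMod 𝒜} (f : M ⟶ N) : f ≫ cokerπ f = 0 := by
  ext m
  change (LinearMap.range (lin f)).mkQ (lin f m) = 0
  rw [Submodule.mkQ_apply, Submodule.Quotient.mk_eq_zero]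
  exact ⟨_, rfl⟩

theorem cokerπ_eq_zero {M N : GrMod 𝒜} (f : M ⟶ N) {n : N.carrier}
    (h : lin (cokerπ f) n = 0) : ∃ m, lin f m = n := by
  change (LinearMap.range (lin f)).mkQ n = 0 at h
  rw [Submodule.mkQ_apply, Submodule.Quotient.mk_eq_zero] at h
  exact h

theorem injective_of_mono {M N : GrMod 𝒜} (f : M ⟶ N) [Mono f] :
    Function.Injective (lin f) := by
  have h : kerι f = 0 := by
    rw [← cancel_mono f, kerι_comp, zero_comp]
  rw [← LinearMap.ker_eq_bot, eq_bot_iff]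
  intro m hm
  have := congrArg (fun k => lin k (⟨m, hm⟩ : LinearMap.ker (lin f))) h
  exact this

theorem surjective_of_epi {M N : GrMod 𝒜} (f : M ⟶ N) [Epi f] :
    Function.Surjective (lin f) := by
  have h : cokerπ f = 0 := by
    rw [← cancel_epi f, comp_cokerπ, comp_zero]
  intro n
  exact cokerπ_eq_zero f (by rw [h]; rfl)

theorem mono_of_injective {M N : GrMod 𝒜} (f : M ⟶ N) (hf : Function.Injective (lin f)) :
    Mono f :=
  ⟨fun a b hab => by ext m; exact hf (congrArg (fun k => lin k m) hab)⟩

/-- Factorization through an injective graded map. -/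
def liftInj {T M N : GrMod 𝒜} (f : M ⟶ N) (hf : Function.Injective (lin f)) (t : T ⟶ N)
    (ht : ∀ x, ∃ m, lin f m = lin t x) : T ⟶ M :=
  mkHom
    ((LinearEquiv.ofInjective (lin f) hf).symm.toLinearMap ∘ₗ
      (lin t).codRestrict (LinearMap.range (lin f)) (fun x => ht x)) <| by
    intro g x hx
    set y := ((LinearEquiv.ofInjective (lin f) hf).symm.toLinearMap ∘ₗ
      (lin t).codRestrict (LinearMap.range (lin f)) (fun x => ht x)) x with hy
    have h1 : lin f y = lin t x := by
      have := (LinearEquiv.ofInjective (lin f) hf).apply_symm_apply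
        ((lin t).codRestrict (LinearMap.range (lin f)) (fun x => ht x) x)
      exact congrArg Subtype.val this
    refine mem_of_component M.internal fun k hk => hf ?_
    rw [lin_component, h1, component_ne N.internal hk (lin_mem t hx), map_zero]

theorem liftInj_comp {T M N : GrMod 𝒜} (f : M ⟶ N) (hf : Function.Injective (lin f))
    (t : T ⟶ N) (ht : ∀ x, ∃ m, lin f m = lin t x) : liftInj f hf t ht ≫ f = t := by
  ext x
  have := (LinearEquiv.ofInjective (lin f) hf).apply_symm_apply
    ((lin t).codRestrict (LinearMap.range (lin f)) (fun x => ht x) x)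
  exact congrArg Subtype.val this

/-- Factorization through a surjective graded map. -/
def descSurj {T M N : GrMod 𝒜} (f : M ⟶ N) (hf : Function.Surjective (lin f)) (t : M ⟶ T)
    (ht : ∀ x, lin f x = 0 → lin t x = 0) : N ⟶ T :=
  mkHom
    ((LinearMap.ker (lin f)).liftQ (lin t) (fun x hx => ht x hx) ∘ₗ
      ((lin f).quotKerEquivOfSurjective hf).symm.toLinearMap) <| by
    intro g n hn
    obtain ⟨m, rfl⟩ := hf n
    have hm : lin f (component M.internal g m) = lin f m := by
      rw [lin_component, component_same N.internal hn]
    rw [← hm]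
    have : ((lin f).quotKerEquivOfSurjective hf).symm (lin f (component M.internal g m))
        = Submodule.Quotient.mk (component M.internal g m) := by
      rw [LinearEquiv.symm_apply_eq]; rfl
    simp only [LinearMap.comp_apply, LinearEquiv.coe_coe, this]
    exact lin_mem t (component_mem M.internal g m)

theorem comp_descSurj {T M N : GrMod 𝒜} (f : M ⟶ N) (hf : Function.Surjective (lin f))
    (t : M ⟶ T) (ht : ∀ x, lin f x = 0 → lin t x = 0) : f ≫ descSurj f hf t ht = t := by
  ext m
  have : ((lin f).quotKerEquivOfSurjective hf).symm (lin f m) = Submodule.Quotient.mk m := by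
    rw [LinearEquiv.symm_apply_eq]; rfl
  change (LinearMap.ker (lin f)).liftQ (lin t) (fun x hx => ht x hx)
    (((lin f).quotKerEquivOfSurjective hf).symm (lin f m)) = _
  rw [this]; rfl

/-- An injective graded map is a kernel of every map that it is set-theoretically a kernel of. -/
def isLimitOfInj {M N P : GrMod 𝒜} (f : M ⟶ N) (hf : Function.Injective (lin f)) (k : N ⟶ P)
    (w : f ≫ k = 0) (hk : ∀ n, lin k n = 0 → ∃ m, lin f m = n) :
    IsLimit (KernelFork.ofι f w) :=
  haveI := mono_of_injective f hf
  KernelFork.IsLimit.ofι f w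
    (fun t ht => liftInj f hf t (fun x => hk _ (congrArg (fun k => lin k x) ht)))
    (fun t ht => liftInj_comp f hf t _)
    (fun t ht m hm => by rw [← cancel_mono f, hm, liftInj_comp])

theorem epi_of_surjective {M N : GrMod 𝒜} (f : M ⟶ N) (hf : Function.Surjective (lin f)) :
    Epi f :=
  ⟨fun a b hab => by
    ext n
    obtain ⟨m, rfl⟩ := hf n
    exact congrArg (fun k => lin k m) hab⟩

/-- A surjective graded map is a cokernel of every map whose image is its kernel. -/
def isColimitOfSurj {M N P : GrMod 𝒜} (f : M ⟶ N) (hf : Function.Surjective (lin f))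
    (k : P ⟶ M) (w : k ≫ f = 0) (hk : ∀ m, lin f m = 0 → ∃ p, lin k p = m) :
    IsColimit (CokernelCofork.ofπ f w) :=
  haveI := epi_of_surjective f hf
  CokernelCofork.IsColimit.ofπ f w
    (fun t ht => descSurj f hf t (fun x hx => by
      obtain ⟨p, rfl⟩ := hk x hx
      exact congrArg (fun k => lin k p) ht))
    (fun t ht => comp_descSurj f hf t _)
    (fun t ht m hm => by rw [← cancel_epi f, hm, comp_descSurj])

/-- The zero graded module. -/
def zeroObj : GrMod 𝒜 where
  carrier := PUnit
  gr _ := ⊤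
  internal := isInternal_of_proj (fun m => by rw [Subsingleton.elim m 0]; exact zero_mem _)
    (fun _ => 0) (fun _ _ _ => rfl) (fun _ _ _ _ _ => rfl)
  smul_mem _ _ := trivial

/-- The product of two graded modules. -/
def prodObj (M N : GrMod 𝒜) : GrMod 𝒜 where
  carrier := M.carrier × N.carrier
  gr g := (M.gr g).prod (N.gr g)
  internal := by
    refine isInternal_of_proj (fun x => ?_)
      (fun g => (component M.internal g).prodMap (component N.internal g)) ?_ ?_
    · have h1 : ∀ m : M.carrier, ((m, 0) : M.carrier × N.carrier) ∈
          ⨆ g, (M.gr g).prod (N.gr g) := by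
        intro m
        induction m using internal_induction M.internal with
        | hom g m hm => exact Submodule.mem_iSup_of_mem g ⟨hm, zero_mem _⟩
        | zero => exact zero_mem _
        | add x y hx hy => simpa using add_mem hx hy
      have h2 : ∀ n : N.carrier, ((0, n) : M.carrier × N.carrier) ∈
          ⨆ g, (M.gr g).prod (N.gr g) := by
        intro m
        induction m using internal_induction N.internal with
        | hom g m hm => exact Submodule.mem_iSup_of_mem g ⟨zero_mem _, hm⟩
        | zero => exact zero_mem _
        | add x y hx hy => simpa using add_mem hx hy
      simpa using add_mem (h1 x.1) (h2 x.2)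
    · rintro g ⟨m, n⟩ ⟨hm, hn⟩
      exact Prod.ext (component_same _ hm) (component_same _ hn)
    · rintro g h hgh ⟨m, n⟩ ⟨hm, hn⟩
      exact Prod.ext (component_ne _ hgh hm) (component_ne _ hgh hn)
  smul_mem ha hm := ⟨M.smul_mem ha hm.1, N.smul_mem ha hm.2⟩

instance : HasKernels (GrMod 𝒜) where
  has_limit f := ⟨⟨_, isLimitOfInj (kerι f) Subtype.val_injective f (kerι_comp f)
    (fun n hn => ⟨⟨n, hn⟩, rfl⟩)⟩⟩

instance : HasCokernels (GrMod 𝒜) where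
  has_colimit f := ⟨⟨_, isColimitOfSurj (cokerπ f) (Submodule.mkQ_surjective _) f (comp_cokerπ f)
    (fun _ hn => cokerπ_eq_zero f hn)⟩⟩

instance : HasTerminal (GrMod 𝒜) :=
  (IsTerminal.ofUniqueHom (Y := zeroObj) (fun _ => 0) (fun _ _ => by ext m; rfl)).hasTerminal

instance : HasBinaryProducts (GrMod 𝒜) := by
  have : ∀ M N : GrMod 𝒜, HasLimit (pair M N) := fun M N =>
    ⟨⟨_, BinaryFan.isLimitMk (W := prodObj M N)
        (fst := mkHom (LinearMap.fst A M.carrier N.carrier) (fun _ _ hm => hm.1))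
        (snd := mkHom (LinearMap.snd A M.carrier N.carrier) (fun _ _ hm => hm.2))
      (fun s => mkHom ((lin s.fst).prod (lin s.snd))
        (fun _ _ hm => ⟨lin_mem s.fst hm, lin_mem s.snd hm⟩))
      (fun s => rfl) (fun s => rfl)
      (fun s m h1 h2 => by
        ext x
        exact Prod.ext (congrArg (fun k => lin k x) h1) (congrArg (fun k => lin k x) h2))⟩⟩
  exact hasBinaryProducts_of_hasLimit_pair _

instance : HasFiniteProducts (GrMod 𝒜) := hasFiniteProducts_of_has_binary_and_terminal

instance : Abelian (GrMod 𝒜) where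
  normalMonoOfMono f _ := ⟨⟨_, cokerπ f, comp_cokerπ f,
    isLimitOfInj f (injective_of_mono f) (cokerπ f) (comp_cokerπ f)
      (fun _ hn => cokerπ_eq_zero f hn)⟩⟩
  normalEpiOfEpi f _ := ⟨⟨_, kerι f, kerι_comp f,
    isColimitOfSurj f (surjective_of_epi f) (kerι f) (kerι_comp f)
      (fun m hm => ⟨⟨m, hm⟩, rfl⟩)⟩⟩

/-! Enough injectives. -/

section Injectives

/-- The finitely supported functions `G → N`. For an `A`-module `N` over a graded algebra `A`
they form the graded module with every component equal to `N`, where `a ∈ A_h` sends `n` in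
degree `g` to `a n` in degree `h + g`; this is right adjoint to forgetting the grading. -/
def Coind (G N : Type u) [AddCommGroup N] : Type u := G →₀ N

variable {N : Type u} [AddCommGroup N] [Module K N] [Module A N] [IsScalarTower K A N]

instance : AddCommGroup (Coind G N) := inferInstanceAs (AddCommGroup (G →₀ N))
instance : Module K (Coind G N) := inferInstanceAs (Module K (G →₀ N))

/-- The element `n` placed in degree `g`. -/
def Coind.single (K : Type u) [Field K] {N : Type u} [AddCommGroup N] [Module K N] (g : G) :
    N →ₗ[K] Coind G N :=
  Finsupp.lsingle (M := N) (R := K) g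

/-- The sum of all values. -/
def Coind.total (K : Type u) [Field K] (G : Type u) [AddCommGroup G] {N : Type u}
    [AddCommGroup N] [Module K N] : Coind G N →ₗ[K] N :=
  Finsupp.lsum (M := N) (N := N) K (fun _ : G => LinearMap.id)

theorem Coind.total_single (g : G) (n : N) :
    Coind.total K G (Coind.single K g n) = n := by
  change Finsupp.lsum (M := N) (N := N) K (fun _ : G => LinearMap.id) (Finsupp.lsingle g n) = n
  simp

theorem Coind.hom_ext {P : Type u} [AddCommGroup P] [Module K P] {f f' : Coind G N →ₗ[K] P}
    (h : ∀ g n, f (Coind.single K g n) = f' (Coind.single K g n)) : f = f' :=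
  Finsupp.lhom_ext (M := N) h

/-- The action of elements of degree `h` on `Coind G N`. -/
def Coind.actDeg (h : G) : A →ₗ[K] Coind G N →ₗ[K] Coind G N :=
  LinearMap.flip (Finsupp.lsum (M := N) (N := A →ₗ[K] Coind G N) K
    (fun g : G => LinearMap.flip
      ((Algebra.lsmul K K N : A →ₐ[K] Module.End K N).toLinearMap.compr₂
        (Coind.single K (h + g) : N →ₗ[K] Coind G N))))

theorem Coind.actDeg_single (h g : G) (a : A) (n : N) :
    Coind.actDeg (K := K) h a (Coind.single K g n) = Coind.single K (h + g) (a • n) := by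
  change Finsupp.lsum (M := N) (N := A →ₗ[K] Coind G N) K _ (Finsupp.lsingle g n) a = _
  simp

variable (𝒜) [GradedAlgebra 𝒜]

/-- The action of `A` on `Coind G N`. -/
def Coind.act : A →ₗ[K] Coind G N →ₗ[K] Coind G N :=
  byDegree (DirectSum.Decomposition.isInternal 𝒜) (fun h => Coind.actDeg h)

theorem Coind.act_single {h : G} {a : A} (ha : a ∈ 𝒜 h) (g : G) (n : N) :
    Coind.act (K := K) 𝒜 a (Coind.single K g n) = Coind.single K (h + g) (a • n) := by
  rw [Coind.act, byDegree_of_mem _ _ ha, Coind.actDeg_single]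

/-- The action of `A` on `Coind G N` as an algebra map. -/
def Coind.actHom : A →ₐ[K] Module.End K (Coind G N) :=
  AlgHom.ofLinearMap (Coind.act 𝒜)
    (by
      apply Coind.hom_ext
      intro g n
      rw [Coind.act_single 𝒜 SetLike.GradedOne.one_mem, zero_add, one_smul]; rfl)
    (by
      intro a b
      induction a using internal_induction (DirectSum.Decomposition.isInternal 𝒜) with
      | zero => simp
      | add x y hx hy => rw [add_mul, map_add, map_add, add_mul, hx, hy]
      | hom g a ha =>
        induction b using internal_induction (DirectSum.Decomposition.isInternal 𝒜) with
        | zero => simp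
        | add x y hx hy => rw [mul_add, map_add, map_add, mul_add, hx, hy]
        | hom h b hb =>
          apply Coind.hom_ext
          intro k n
          rw [Coind.act_single 𝒜 (SetLike.GradedMul.mul_mem ha hb), Module.End.mul_apply,
            Coind.act_single 𝒜 hb, Coind.act_single 𝒜 ha, add_assoc, mul_smul])

/-- The `A`-module structure on `Coind G N`. -/
@[reducible] def Coind.module : Module A (Coind G N) where
  smul a x := Coind.act (K := K) 𝒜 a x
  one_smul x := LinearMap.congr_fun (map_one (Coind.actHom (K := K) (N := N) 𝒜)) x
  mul_smul a b x := LinearMap.congr_fun (map_mul (Coind.actHom (K := K) (N := N) 𝒜) a b) x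
  smul_zero a := map_zero (Coind.act (K := K) (N := N) 𝒜 a)
  smul_add a x y := map_add (Coind.act (K := K) (N := N) 𝒜 a) x y
  add_smul a b x := LinearMap.congr_fun (map_add (Coind.act (K := K) (N := N) 𝒜) a b) x
  zero_smul x := LinearMap.congr_fun (map_zero (Coind.act (K := K) (N := N) 𝒜)) x

/-- The coinduced graded module of an `A`-module. -/
def coind (𝒜 : G → Submodule K A) [GradedAlgebra 𝒜] (N : Type u) [AddCommGroup N] [Module K N]
    [Module A N] [IsScalarTower K A N] : GrMod 𝒜 :=
  letI m : Module A (Coind G N) := Coind.module 𝒜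
  { carrier := Coind G N
    module := m
    isScalarTower := ⟨fun c a x =>
      LinearMap.congr_fun (map_smul (Coind.act (K := K) (N := N) 𝒜) c a) x⟩
    gr := fun g => LinearMap.range (Coind.single K g)
    internal := by
      refine isInternal_of_proj (fun x => ?_)
        (fun g => Coind.single K g ∘ₗ Finsupp.lapply (M := N) g) ?_ ?_
      · induction x using Finsupp.induction_linear with
        | zero => exact zero_mem _
        | add x y hx hy => exact add_mem hx hy
        | single g n => exact Submodule.mem_iSup_of_mem g ⟨n, rfl⟩
      · rintro g _ ⟨n, rfl⟩
        change Finsupp.single g (Finsupp.single g n g) = Finsupp.single g n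
        simp
      · rintro g h hgh _ ⟨n, rfl⟩
        change Finsupp.single g (Finsupp.single h n g) = 0
        rw [Finsupp.single_eq_of_ne hgh, Finsupp.single_zero]
    smul_mem := by
      rintro g h a _ ha ⟨n, rfl⟩
      exact ⟨a • n, (Coind.act_single 𝒜 ha h n).symm⟩ }

theorem coind_smul (a : A) (x : (coind 𝒜 N).carrier) :
    a • x = Coind.act (K := K) (N := N) 𝒜 a x := rfl

theorem Coind.total_act (a : A) (x : Coind G N) :
    Coind.total K G (Coind.act 𝒜 a x) = a • Coind.total K G x := by
  induction a using internal_induction (DirectSum.Decomposition.isInternal 𝒜) with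
  | zero => rw [map_zero, LinearMap.zero_apply, map_zero, zero_smul]
  | add a b ha hb => rw [map_add, add_smul, LinearMap.add_apply, map_add, ha, hb]
  | hom g a ha =>
    have key : Coind.total K G ∘ₗ Coind.act 𝒜 a =
        (Algebra.lsmul K K N a : N →ₗ[K] N) ∘ₗ Coind.total K G := by
      apply Coind.hom_ext
      intro h n
      simp only [LinearMap.comp_apply]
      rw [Coind.act_single 𝒜 ha, Coind.total_single, Coind.total_single]
      rfl
    exact LinearMap.congr_fun key x

/-- The counit of the adjunction. -/
def coindTotal : (coind 𝒜 N).carrier →ₗ[A] N where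
  toFun x := Coind.total K G (N := N) x
  map_add' x y := map_add (Coind.total K G (N := N)) x y
  map_smul' a x := Coind.total_act 𝒜 a x

/-- The linear map underlying `toCoind`. -/
def toCoindLin {M : GrMod 𝒜} (f : M.carrier →ₗ[A] N) : M.carrier →ₗ[K] Coind G N :=
  byDegree M.internal (fun g => Coind.single K g ∘ₗ f.restrictScalars K)

theorem toCoindLin_of_mem {M : GrMod 𝒜} (f : M.carrier →ₗ[A] N) {g : G} {m : M.carrier}
    (hm : m ∈ M.gr g) : toCoindLin 𝒜 f m = Coind.single K g (f m) :=
  byDegree_of_mem _ _ hm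

theorem toCoindLin_smul {M : GrMod 𝒜} (f : M.carrier →ₗ[A] N) (a : A) (m : M.carrier) :
    toCoindLin 𝒜 f (a • m) = Coind.act 𝒜 a (toCoindLin 𝒜 f m) := by
  induction a using internal_induction (DirectSum.Decomposition.isInternal 𝒜) with
  | zero => rw [zero_smul, map_zero, map_zero, LinearMap.zero_apply]
  | add a b ha hb => rw [map_add, add_smul, map_add, LinearMap.add_apply, ha, hb]
  | hom g a ha =>
    induction m using internal_induction M.internal with
    | zero => rw [smul_zero, map_zero, map_zero]
    | add x y hx hy => rw [smul_add, map_add, map_add, hx, hy, ← map_add]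
    | hom h m hm =>
      rw [toCoindLin_of_mem 𝒜 f hm, toCoindLin_of_mem 𝒜 f (M.smul_mem ha hm),
        Coind.act_single 𝒜 ha, map_smul]

/-- The graded map into the coinduced module given by a map of modules. -/
def toCoind {M : GrMod 𝒜} (f : M.carrier →ₗ[A] N) : M ⟶ coind 𝒜 N :=
  mkHom
    { toFun := fun m => toCoindLin 𝒜 f m
      map_add' := map_add (toCoindLin 𝒜 f)
      map_smul' := toCoindLin_smul 𝒜 f }
    (fun _ m hm => ⟨f m, (toCoindLin_of_mem 𝒜 f hm).symm⟩)

theorem toCoind_apply {M : GrMod 𝒜} (f : M.carrier →ₗ[A] N) {g : G} {m : M.carrier}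
    (hm : m ∈ M.gr g) : lin (toCoind 𝒜 f) m = (Coind.single K g (f m) : Coind G N) :=
  toCoindLin_of_mem 𝒜 f hm

theorem coindTotal_toCoind {M : GrMod 𝒜} (f : M.carrier →ₗ[A] N) (m : M.carrier) :
    coindTotal 𝒜 (lin (toCoind 𝒜 f) m) = f m := by
  induction m using internal_induction M.internal with
  | zero => simp
  | add x y hx hy => simp only [map_add, hx, hy]
  | hom h m hm =>
    rw [toCoind_apply 𝒜 f hm]
    exact Coind.total_single h (f m)

theorem coind_hom_ext {M : GrMod 𝒜} {φ ψ : M ⟶ coind 𝒜 N}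
    (h : ∀ m, coindTotal 𝒜 (lin φ m) = coindTotal 𝒜 (lin ψ m)) : φ = ψ := by
  ext m
  induction m using internal_induction M.internal with
  | zero => simp
  | add x y hx hy => simp only [map_add, hx, hy]
  | hom g m hm =>
    obtain ⟨n, hn⟩ := lin_mem φ hm
    obtain ⟨n', hn'⟩ := lin_mem ψ hm
    have := h m
    rw [← hn, ← hn'] at this ⊢
    have e : n = n' := by
      have e1 : coindTotal 𝒜 (Coind.single K g n : Coind G N) = n := Coind.total_single g n
      have e2 : coindTotal 𝒜 (Coind.single K g n' : Coind G N) = n' := Coind.total_single g n'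
      exact e1.symm.trans (this.trans e2)
    rw [e]

theorem injective_coind (hN : Injective (ModuleCat.of A N)) : Injective (coind 𝒜 N) where
  factors {X Y} g f _ := by
    have hm : Mono (ModuleCat.ofHom (lin f)) :=
      (ModuleCat.mono_iff_injective _).2 (injective_of_mono f)
    let k := Injective.factorThru (ModuleCat.ofHom (coindTotal 𝒜 ∘ₗ lin g))
      (ModuleCat.ofHom (lin f))
    refine ⟨toCoind 𝒜 k.hom, coind_hom_ext 𝒜 fun x => ?_⟩
    refine (coindTotal_toCoind 𝒜 k.hom (lin f x)).trans ?_
    exact congrArg (fun k => k.hom x) (Injective.comp_factorThru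
      (ModuleCat.ofHom (coindTotal 𝒜 ∘ₗ lin g)) (ModuleCat.ofHom (lin f)))

theorem nonempty_injectivePresentation (M : GrMod 𝒜) (hN : Injective (ModuleCat.of A N))
    (i : M.carrier →ₗ[A] N) (hi : Function.Injective i) : Nonempty (InjectivePresentation M) :=
  ⟨⟨coind 𝒜 N, injective_coind 𝒜 hN, toCoind 𝒜 i, mono_of_injective _ fun x y hxy => hi (by
    have := congrArg (coindTotal 𝒜) hxy
    rwa [coindTotal_toCoind, coindTotal_toCoind] at this)⟩⟩

instance : EnoughInjectives (GrMod 𝒜) where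
  presentation M := by
    obtain ⟨J, hJ, i, hi⟩ := (EnoughInjectives.presentation (ModuleCat.of A M.carrier)).some
    let _ : Module K J := Module.compHom J (algebraMap K A)
    have _ : IsScalarTower K A J := ⟨fun c a x => by
      change (c • a) • x = algebraMap K A c • (a • x)
      rw [Algebra.smul_def, mul_smul]⟩
    exact nonempty_injectivePresentation (N := J) 𝒜 M hJ i.hom
      ((ModuleCat.mono_iff_injective _).1 hi)

end Injectives

/-! ### Shifts and (graded) Ext -/

/-- The shift `M[h]`, with `M[h]_g = M_{h+g}`. -/
def shift (h : G) (M : GrMod 𝒜) : GrMod 𝒜 where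
  carrier := M.carrier
  gr g := M.gr (h + g)
  internal := by
    refine isInternal_of_proj (fun m => ?_) (fun g => component M.internal (h + g))
      (fun g m hm => component_same _ hm)
      (fun g k hgk m hm => component_ne _ (fun e => hgk (add_left_cancel e)) hm)
    have := M.internal.submodule_iSup_eq_top
    rw [← (Equiv.addLeft h).iSup_comp] at this
    have hm : m ∈ ⨆ g, M.gr (Equiv.addLeft h g) := by rw [this]; trivial
    exact hm
  smul_mem := by
    intro g k a m ha hm
    have := M.smul_mem ha hm
    rwa [show h + (g + k) = g + (h + k) by abel]

/-- The functor `HOM_A(X, -)_h` from graded modules to vector spaces. -/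
def homDegFunctor (h : G) (X : GrMod 𝒜) : GrMod 𝒜 ⥤ ModuleCat.{u} K where
  obj Y := ModuleCat.of K (homDeg h X Y)
  map {Y Z} φ := ModuleCat.ofHom
    { toFun := fun f => ⟨lin φ ∘ₗ f.1, fun g m hm => lin_mem φ (f.2 g m hm)⟩
      map_add' := fun f f' => Subtype.ext (LinearMap.comp_add f.1 f'.1 (lin φ))
      map_smul' := fun c f => Subtype.ext (by
        ext x
        exact LinearMap.map_smul_of_tower (lin φ) c (f.1 x)) }
  map_id _ := rfl
  map_comp _ _ := rfl

instance (h : G) (X : GrMod 𝒜) : (homDegFunctor h X).Additive where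
  map_add := rfl

/-- `Ext^n_{A-gr}(X, Y)`: the `n`-th right derived functor of `Hom_{A-gr}(X, -)` at `Y`. -/
def grExt [GradedAlgebra 𝒜] (n : ℕ) (X Y : GrMod 𝒜) : ModuleCat.{u} K :=
  (((linearCoyoneda K (GrMod 𝒜)).obj (Opposite.op X)).rightDerived n).obj Y

/-- `EXT^n_A(X, Y)_h`: the `n`-th right derived functor of `HOM_A(X, -)_h` at `Y`. -/
def extDeg [GradedAlgebra 𝒜] (n : ℕ) (h : G) (X Y : GrMod 𝒜) : ModuleCat.{u} K :=
  ((homDegFunctor h X).rightDerived n).obj Y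

end GrMod

end GrMod

/-! ### Gradings on tensor products and the enveloping algebra -/

section Tensor

variable {K : Type u} [Field K] {G : Type u} [AddCommGroup G] [DecidableEq G]

/-- The total grading on a tensor product: `(M ⊗ N)_g = ∑_{h + k = g} M_h ⊗ N_k`. -/
def tensorGr {M N : Type u} [AddCommGroup M] [Module K M] [AddCommGroup N] [Module K N]
    (ℳ : G → Submodule K M) (𝒩 : G → Submodule K N) (g : G) : Submodule K (M ⊗[K] N) :=
  Submodule.span K {z | ∃ h k, h + k = g ∧ ∃ m ∈ ℳ h, ∃ n ∈ 𝒩 k, m ⊗ₜ[K] n = z}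

theorem tmul_mem_tensorGr {M N : Type u} [AddCommGroup M] [Module K M] [AddCommGroup N]
    [Module K N] {ℳ : G → Submodule K M} {𝒩 : G → Submodule K N} {h k : G} {m : M} {n : N}
    (hm : m ∈ ℳ h) (hn : n ∈ 𝒩 k) : m ⊗ₜ[K] n ∈ tensorGr ℳ 𝒩 (h + k) :=
  Submodule.subset_span ⟨h, k, rfl, m, hm, n, hn, rfl⟩

theorem tensorGr_internal {M N : Type u} [AddCommGroup M] [Module K M] [AddCommGroup N]
    [Module K N] {ℳ : G → Submodule K M} {𝒩 : G → Submodule K N}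
    (hM : DirectSum.IsInternal ℳ) (hN : DirectSum.IsInternal 𝒩) :
    DirectSum.IsInternal (tensorGr ℳ 𝒩) := by
  have hp : ∀ g h k : G, ∀ m ∈ ℳ h, ∀ n ∈ 𝒩 k,
      TensorProduct.lift (byDegree hM (fun h =>
        (TensorProduct.mk K M N).compl₂ (component hN (g - h)))) (m ⊗ₜ[K] n) =
        if h + k = g then m ⊗ₜ[K] n else 0 := by
    intro g h k m hm n hn
    rw [TensorProduct.lift.tmul, byDegree_of_mem _ _ hm]
    simp only [LinearMap.compl₂_apply, TensorProduct.mk_apply]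
    split_ifs with hg
    · rw [← hg, add_sub_cancel_left, component_same hN hn]
    · rw [component_ne hN (fun e => hg (by rw [← e]; abel)) hn, TensorProduct.tmul_zero]
  refine isInternal_of_proj (fun z => ?_) (fun g => TensorProduct.lift (byDegree hM (fun h =>
    (TensorProduct.mk K M N).compl₂ (component hN (g - h))))) ?_ ?_
  · induction z using TensorProduct.induction_on with
    | zero => exact zero_mem _
    | add x y hx hy => exact add_mem hx hy
    | tmul m n =>
      induction m using internal_induction hM with
      | zero => rw [TensorProduct.zero_tmul]; exact zero_mem _
      | add x y hx hy => rw [TensorProduct.add_tmul]; exact add_mem hx hy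
      | hom h m hm =>
        induction n using internal_induction hN with
        | zero => rw [TensorProduct.tmul_zero]; exact zero_mem _
        | add x y hx hy => rw [TensorProduct.tmul_add]; exact add_mem hx hy
        | hom k n hn => exact Submodule.mem_iSup_of_mem (h + k) (tmul_mem_tensorGr hm hn)
  · intro g z hz
    induction hz using Submodule.span_induction with
    | zero => simp
    | add x y _ _ hx hy => rw [map_add, hx, hy]
    | smul c x _ hx => rw [map_smul, hx]
    | mem x hx =>
      obtain ⟨h, k, hg, m, hm, n, hn, rfl⟩ := hx
      rw [hp g h k m hm n hn, if_pos hg]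
  · intro g g' hgg' z hz
    induction hz using Submodule.span_induction with
    | zero => simp
    | add x y _ _ hx hy => rw [map_add, hx, hy, add_zero]
    | smul c x _ hx => rw [map_smul, hx, smul_zero]
    | mem x hx =>
      obtain ⟨h, k, hg, m, hm, n, hn, rfl⟩ := hx
      rw [hp g h k m hm n hn, if_neg (fun e => hgg' (e.symm.trans hg))]

variable {A : Type u} [Ring A] [Algebra K A]

/-- The grading of the opposite algebra. -/
def opGr (𝒜 : G → Submodule K A) (g : G) : Submodule K Aᵐᵒᵖ :=
  (𝒜 g).map (MulOpposite.opLinearEquiv K : A ≃ₗ[K] Aᵐᵒᵖ).toLinearMap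

theorem op_mem_opGr {𝒜 : G → Submodule K A} {g : G} {a : A} (ha : a ∈ 𝒜 g) :
    MulOpposite.op a ∈ opGr 𝒜 g := ⟨a, ha, rfl⟩

theorem opGr_internal {𝒜 : G → Submodule K A} (hA : DirectSum.IsInternal 𝒜) :
    DirectSum.IsInternal (opGr 𝒜) := by
  refine isInternal_of_proj (fun z => ?_)
    (fun g => (MulOpposite.opLinearEquiv K : A ≃ₗ[K] Aᵐᵒᵖ).toLinearMap ∘ₗ component hA g ∘ₗ
      (MulOpposite.opLinearEquiv K : A ≃ₗ[K] Aᵐᵒᵖ).symm.toLinearMap) ?_ ?_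
  · induction z using MulOpposite.rec' with
    | _ a =>
      induction a using internal_induction hA with
      | zero => exact zero_mem _
      | add x y hx hy => rw [MulOpposite.op_add]; exact add_mem hx hy
      | hom g a ha => exact Submodule.mem_iSup_of_mem g (op_mem_opGr ha)
  · rintro g _ ⟨a, ha, rfl⟩
    simp [component_same hA ha]
  · rintro g h hgh _ ⟨a, ha, rfl⟩
    simp [component_ne hA hgh ha]

/-- The grading `A^e_g = ∑_h A_h ⊗ A_{g-h}` of the enveloping algebra `A^e = A ⊗ A^op`. -/
def envGr (𝒜 : G → Submodule K A) : G → Submodule K (A ⊗[K] Aᵐᵒᵖ) :=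
  tensorGr 𝒜 (opGr 𝒜)

instance envGradedMonoid (𝒜 : G → Submodule K A) [GradedAlgebra 𝒜] :
    SetLike.GradedMonoid (envGr 𝒜) where
  one_mem := by
    have := tmul_mem_tensorGr (ℳ := 𝒜) (𝒩 := opGr 𝒜) (SetLike.GradedOne.one_mem (A := 𝒜))
      (op_mem_opGr (SetLike.GradedOne.one_mem (A := 𝒜)))
    rwa [add_zero] at this
  mul_mem {g g' x y} hx hy := by
    have hx' : x ∈ tensorGr 𝒜 (opGr 𝒜) g := hx
    have hy' : y ∈ tensorGr 𝒜 (opGr 𝒜) g' := hy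
    change x * y ∈ tensorGr 𝒜 (opGr 𝒜) (g + g')
    clear hx hy
    induction hx' using Submodule.span_induction with
    | zero => rw [zero_mul]; exact zero_mem _
    | add x x' _ _ hx hx' => rw [add_mul]; exact add_mem hx hx'
    | smul c x _ hx => rw [smul_mul_assoc]; exact Submodule.smul_mem _ c hx
    | mem x hx =>
      induction hy' using Submodule.span_induction with
      | zero => rw [mul_zero]; exact zero_mem _
      | add y y' _ _ hy hy' => rw [mul_add]; exact add_mem hy hy'
      | smul c y _ hy => rw [mul_smul_comm]; exact Submodule.smul_mem _ c hy
      | mem y hy =>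
        obtain ⟨h, k, rfl, a, ha, _, ⟨b, hb, rfl⟩, rfl⟩ := hx
        obtain ⟨h', k', rfl, a', ha', _, ⟨b', hb', rfl⟩, rfl⟩ := hy
        rw [Algebra.TensorProduct.tmul_mul_tmul,
          show h + k + (h' + k') = (h + h') + (k' + k) by abel]
        exact tmul_mem_tensorGr (SetLike.GradedMul.mul_mem ha ha')
          (op_mem_opGr (SetLike.GradedMul.mul_mem hb' hb))

instance envGradedAlgebra (𝒜 : G → Submodule K A) [GradedAlgebra 𝒜] :
    GradedAlgebra (envGr 𝒜) where
  toGradedMonoid := envGradedMonoid 𝒜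
  toDecomposition := DirectSum.IsInternal.chooseDecomposition (envGr 𝒜) (tensorGr_internal (DirectSum.Decomposition.isInternal 𝒜)
    (opGr_internal (DirectSum.Decomposition.isInternal 𝒜)))

end Tensor

/-! ### Color Hopf algebras -/

section Hopf

variable {K : Type u} [Field K] {G : Type u} [AddCommGroup G] [DecidableEq G]

/-- A bicharacter `χ : G × G → K^×`. -/
structure Bicharacter (K G : Type u) [Field K] [AddCommGroup G] where
  /-- the underlying function -/
  toFun : G → G → Kˣ
  map_add_left : ∀ g h k, toFun (g + h) k = toFun g k * toFun h k
  map_add_right : ∀ g h k, toFun g (h + k) = toFun g h * toFun g k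

instance : CoeFun (Bicharacter K G) (fun _ => G → G → Kˣ) := ⟨Bicharacter.toFun⟩

theorem Bicharacter.zero_left (χ : Bicharacter K G) (k : G) : χ 0 k = 1 := by
  have := χ.map_add_left 0 0 k
  rw [add_zero] at this
  exact left_eq_mul.1 this

/-- The operator on `M = ⨁ M_g` acting on `M_g` as the scalar `c g`. -/
def scale {M : Type u} [AddCommGroup M] [Module K M] {ℳ : G → Submodule K M}
    (hM : DirectSum.IsInternal ℳ) (c : G → Kˣ) : M →ₗ[K] M :=
  byDegree hM (fun g => (c g : K) • LinearMap.id)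

theorem scale_of_mem {M : Type u} [AddCommGroup M] [Module K M] {ℳ : G → Submodule K M}
    (hM : DirectSum.IsInternal ℳ) (c : G → Kˣ) {g : G} {m : M} (hm : m ∈ ℳ g) :
    scale hM c m = (c g : K) • m := by
  rw [scale, byDegree_of_mem hM _ hm]; rfl

variable {A : Type u} [Ring A] [Algebra K A]

/-- The multiplication of `(A ⊗ A)^χ`:
`(a ⊗ b) * (a' ⊗ b') = χ(|b|, |a'|) a a' ⊗ b b'` for homogeneous `b` and `a'`. -/
def twMul (χ : Bicharacter K G) (𝒜 : G → Submodule K A) [GradedAlgebra 𝒜] :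
    A ⊗[K] A →ₗ[K] A ⊗[K] A →ₗ[K] A ⊗[K] A :=
  TensorProduct.lift (LinearMap.flip
    (byDegree (P := A →ₗ[K] A ⊗[K] A →ₗ[K] A ⊗[K] A) (DirectSum.Decomposition.isInternal 𝒜)
      fun k => LinearMap.flip ((TensorProduct.mapBilinear (RingHom.id K) A A A A).compl₁₂
        (LinearMap.lcomp K A (scale (DirectSum.Decomposition.isInternal 𝒜) (χ k)) ∘ₗ
          LinearMap.mul K A)
        (LinearMap.mul K A))))

theorem twMul_tmul (χ : Bicharacter K G) (𝒜 : G → Submodule K A) [GradedAlgebra 𝒜]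
    {h k : G} {b a' : A} (hb : b ∈ 𝒜 h) (ha' : a' ∈ 𝒜 k) (a b' : A) :
    twMul χ 𝒜 (a ⊗ₜ b) (a' ⊗ₜ b') = (χ h k : K) • ((a * a') ⊗ₜ[K] (b * b')) := by
  rw [twMul, TensorProduct.lift.tmul, LinearMap.flip_apply, byDegree_of_mem _ _ hb]
  simp [scale_of_mem _ _ ha', TensorProduct.smul_tmul']

/-- A color Hopf algebra: a `(G, χ)`-Hopf algebra with bijective antipode. -/
structure ColorHopfAlgebra (χ : Bicharacter K G) (𝒜 : G → Submodule K A) [GradedAlgebra 𝒜]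
    [Coalgebra K A] where
  /-- the coalgebra is graded -/
  comul_mem : ∀ {g : G} {a : A}, a ∈ 𝒜 g → Coalgebra.comul (R := K) a ∈ tensorGr 𝒜 𝒜 g
  counit_eq_zero : ∀ {g : G} {a : A}, a ∈ 𝒜 g → g ≠ 0 → Coalgebra.counit (R := K) a = 0
  /-- the counit is an algebra map -/
  counit_one : Coalgebra.counit (R := K) (1 : A) = 1
  counit_mul : ∀ a b : A, Coalgebra.counit (R := K) (a * b) =
    Coalgebra.counit (R := K) a * Coalgebra.counit (R := K) b
  /-- the comultiplication is an algebra map to `(A ⊗ A)^χ` -/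
  comul_one : Coalgebra.comul (R := K) (1 : A) = 1 ⊗ₜ 1
  comul_mul : ∀ a b : A, Coalgebra.comul (R := K) (a * b) =
    twMul χ 𝒜 (Coalgebra.comul a) (Coalgebra.comul b)
  /-- the antipode, a graded map -/
  antipode : A →ₗ[K] A
  antipode_mem : ∀ {g : G} {a : A}, a ∈ 𝒜 g → antipode a ∈ 𝒜 g
  /-- `∑ a₁ S(a₂) = ε(a) = ∑ S(a₁) a₂` -/
  mul_lTensor_comul : ∀ a : A, LinearMap.mul' K A
    (antipode.lTensor A (Coalgebra.comul a)) = algebraMap K A (Coalgebra.counit a)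
  mul_rTensor_comul : ∀ a : A, LinearMap.mul' K A
    (antipode.rTensor A (Coalgebra.comul a)) = algebraMap K A (Coalgebra.counit a)
  antipode_bijective : Function.Bijective antipode

namespace ColorHopfAlgebra

variable {χ : Bicharacter K G} {𝒜 : G → Submodule K A} [GradedAlgebra 𝒜] [Coalgebra K A]
variable (H : ColorHopfAlgebra χ 𝒜)


theorem antipode_one : H.antipode 1 = 1 := by
  have := H.mul_rTensor_comul 1
  rw [H.comul_one, H.counit_one] at this
  simpa using this

/-- `Φ(x ⊗ y) = S(x) y`. -/
def leftMul : A ⊗[K] A →ₗ[K] A := LinearMap.mul' K A ∘ₗ H.antipode.rTensor A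

theorem leftMul_tmul (x y : A) : H.leftMul (x ⊗ₜ y) = H.antipode x * y := by
  simp [leftMul]

theorem leftMul_twMul (z : A ⊗[K] A) (b c : A) :
    H.leftMul (twMul χ 𝒜 z (b ⊗ₜ 1)) * c = H.leftMul (twMul χ 𝒜 z (b ⊗ₜ c)) := by
  induction z using TensorProduct.induction_on with
  | zero => simp
  | add x y hx hy => simp only [map_add, LinearMap.add_apply, add_mul, hx, hy]
  | tmul x y =>
    induction y using internal_induction (DirectSum.Decomposition.isInternal 𝒜) with
    | zero => simp
    | add y y' hy hy' =>
      simp only [TensorProduct.tmul_add, map_add, LinearMap.add_apply, add_mul, hy, hy']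
    | hom g y hy =>
      induction b using internal_induction (DirectSum.Decomposition.isInternal 𝒜) with
      | zero => simp
      | add b b' hb hb' =>
        simp only [TensorProduct.add_tmul, map_add, add_mul, hb, hb']
      | hom h b hb =>
        rw [twMul_tmul χ 𝒜 hy hb, twMul_tmul χ 𝒜 hy hb, map_smul, map_smul, leftMul_tmul,
          leftMul_tmul]
        simp [mul_assoc]

open WithConv in
theorem id_conv_antipode :
    (toConv LinearMap.id : WithConv (A →ₗ[K] A)) * toConv H.antipode = 1 := by
  ext a
  exact H.mul_lTensor_comul a

open WithConv in
theorem leftMul_twMul_comul (a b : A) :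
    H.leftMul (twMul χ 𝒜 (Coalgebra.comul a) (b ⊗ₜ 1)) =
      (Coalgebra.counit a : K) • H.antipode b := by
  let p : A →ₗ[K] A := H.leftMul ∘ₗ twMul χ 𝒜 (Coalgebra.comul a) ∘ₗ
    (TensorProduct.mk K A A).flip 1
  have h1 : toConv p * toConv LinearMap.id =
      (Coalgebra.counit a : K) • (1 : WithConv (A →ₗ[K] A)) := by
    ext b
    have key : LinearMap.mul' K A ∘ₗ TensorProduct.map p LinearMap.id =
        H.leftMul ∘ₗ twMul χ 𝒜 (Coalgebra.comul a) := by
      ext b c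
      simp [p, leftMul_twMul]
    refine (LinearMap.congr_fun key (Coalgebra.comul b)).trans ?_
    rw [LinearMap.comp_apply, ← H.comul_mul]
    refine (H.mul_rTensor_comul (a * b)).trans ?_
    rw [H.counit_mul, map_mul]
    exact (Algebra.smul_def _ _).symm
  have h2 : toConv p = (Coalgebra.counit a : K) • toConv H.antipode := by
    rw [← mul_one (toConv p), ← H.id_conv_antipode, ← mul_assoc, h1, smul_mul_assoc, one_mul]
  exact LinearMap.congr_fun (congrArg ofConv h2) b

open WithConv in
/-- The antipode satisfies `S(ab) = χ(|a|, |b|) S(b) S(a)` for homogeneous `a`, `b`. -/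
theorem antipode_mul {g k : G} {a b : A} (ha : a ∈ 𝒜 g) (hb : b ∈ 𝒜 k) :
    H.antipode (a * b) = (χ g k : K) • (H.antipode b * H.antipode a) := by
  let t : A →ₗ[K] A := scale (DirectSum.Decomposition.isInternal 𝒜) (fun g => χ g k)
  let f : A →ₗ[K] A := H.antipode ∘ₗ LinearMap.mulRight K b
  have h1 : toConv f * toConv t =
      toConv (LinearMap.mulLeft K (H.antipode b) ∘ₗ ofConv (1 : WithConv (A →ₗ[K] A))) := by
    ext a
    have key : LinearMap.mul' K A ∘ₗ TensorProduct.map f t =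
        H.leftMul ∘ₗ (twMul χ 𝒜).flip (b ⊗ₜ 1) := by
      apply TensorProduct.ext
      ext x : 1
      refine hom_ext_of_internal (DirectSum.Decomposition.isInternal 𝒜) fun h y hy => ?_
      simp [f, t, scale_of_mem _ _ hy, twMul_tmul χ 𝒜 hy hb, leftMul_tmul]
    refine (LinearMap.congr_fun key (Coalgebra.comul a)).trans ?_
    refine (H.leftMul_twMul_comul a b).trans ?_
    rw [Algebra.smul_def, Algebra.commutes]
    rfl
  have h2 : toConv t * toConv (H.antipode ∘ₗ t) = (1 : WithConv (A →ₗ[K] A)) := by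
    apply ofConv_injective
    refine hom_ext_of_internal (DirectSum.Decomposition.isInternal 𝒜) fun g a ha => ?_
    have key : ∀ z ∈ tensorGr 𝒜 𝒜 g, LinearMap.mul' K A
        (TensorProduct.map t (H.antipode ∘ₗ t) z) =
        (χ g k : K) • LinearMap.mul' K A (H.antipode.lTensor A z) := by
      intro z hz
      induction hz using Submodule.span_induction with
      | zero => simp
      | add x y _ _ hx hy => simp only [map_add, smul_add, hx, hy]
      | smul c x _ hx => simp only [map_smul, hx, smul_comm c]
      | mem x hx =>
        obtain ⟨h, l, rfl, m, hm, n, hn, rfl⟩ := hx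
        simp [t, scale_of_mem _ _ hm, scale_of_mem _ _ hn, χ.map_add_left, smul_smul, mul_comm]
    refine (key _ (H.comul_mem ha)).trans ?_
    rw [H.mul_lTensor_comul]
    by_cases hg : g = 0
    · rw [hg, χ.zero_left, Units.val_one, one_smul]; rfl
    · change _ = algebraMap K A (Coalgebra.counit a)
      rw [H.counit_eq_zero ha hg, map_zero, smul_zero]
  have h3 : ∀ (c : A) (u v : WithConv (A →ₗ[K] A)),
      toConv (LinearMap.mulLeft K c ∘ₗ ofConv u) * v =
        toConv (LinearMap.mulLeft K c ∘ₗ ofConv (u * v)) := by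
    intro c u v
    ext x
    have key : LinearMap.mul' K A ∘ₗ
          TensorProduct.map (LinearMap.mulLeft K c ∘ₗ ofConv u) (ofConv v) =
        LinearMap.mulLeft K c ∘ₗ LinearMap.mul' K A ∘ₗ
          TensorProduct.map (ofConv u) (ofConv v) := by
      ext x y
      simp [mul_assoc]
    exact LinearMap.congr_fun key (Coalgebra.comul x)
  have h4 : toConv f =
      toConv (LinearMap.mulLeft K (H.antipode b) ∘ₗ (H.antipode ∘ₗ t)) := by
    rw [← mul_one (toConv f), ← h2, ← mul_assoc, h1, h3, one_mul]
  have h5 := LinearMap.congr_fun (congrArg ofConv h4) a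
  change H.antipode (a * b) = H.antipode b * H.antipode (t a) at h5
  rw [h5, scale_of_mem _ _ ha, map_smul, mul_smul_comm]

end ColorHopfAlgebra

end Hopf

/-! ### The graded modules `𝕂`, `A` and `^{ad}M`, and graded Hochschild cohomology -/

section Cohomology

variable {K : Type u} [Field K] {G : Type u} [AddCommGroup G] [DecidableEq G]
variable {A : Type u} [Ring A] [Algebra K A]

section Regular

attribute [local instance] TensorProduct.Algebra.module

/-- The graded `A^e`-module `A`, with `(a ⊗ a') x = a x a'`. -/
def regular (𝒜 : G → Submodule K A) [GradedAlgebra 𝒜] : GrMod (envGr 𝒜) where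
  carrier := A
  isScalarTower := ⟨fun c z x => by
    change TensorProduct.Algebra.moduleAux (c • z) x = c • TensorProduct.Algebra.moduleAux z x
    rw [map_smul]; rfl⟩
  gr := 𝒜
  internal := DirectSum.Decomposition.isInternal 𝒜
  smul_mem {g h z x} hz hx := by
    have hz' : z ∈ tensorGr 𝒜 (opGr 𝒜) g := hz
    clear hz
    change TensorProduct.Algebra.moduleAux z x ∈ 𝒜 (g + h)
    induction hz' using Submodule.span_induction with
    | zero => rw [map_zero, LinearMap.zero_apply]; exact zero_mem _
    | add y y' _ _ hy hy' => rw [map_add, LinearMap.add_apply]; exact add_mem hy hy'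
    | smul c y _ hy => rw [map_smul, LinearMap.smul_apply]; exact Submodule.smul_mem _ c hy
    | mem y hy =>
      obtain ⟨k, l, rfl, a, ha, _, ⟨b, hb, rfl⟩, rfl⟩ := hy
      change a * (x * b) ∈ 𝒜 (k + l + h)
      rw [show k + l + h = k + (h + l) by abel]
      exact SetLike.GradedMul.mul_mem ha (SetLike.GradedMul.mul_mem hx hb)

theorem regular_smul (𝒜 : G → Submodule K A) [GradedAlgebra 𝒜] (a b x : A) :
    ((a ⊗ₜ[K] MulOpposite.op b) • (show (regular 𝒜).carrier from x) : (regular 𝒜).carrier) =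
      (a * x * b : A) := by
  rw [mul_assoc]
  exact TensorProduct.Algebra.smul_def a (MulOpposite.op b) x

end Regular

namespace ColorHopfAlgebra

variable {χ : Bicharacter K G} {𝒜 : G → Submodule K A} [GradedAlgebra 𝒜] [Coalgebra K A]
variable (H : ColorHopfAlgebra χ 𝒜)

/-- The counit as a ring homomorphism. -/
def counitHom : A →+* K where
  toFun a := Coalgebra.counit a
  map_one' := H.counit_one
  map_mul' := H.counit_mul
  map_zero' := map_zero _
  map_add' := map_add _

/-- The trivial graded `A`-module `𝕂`, concentrated in degree `0`, with `a c = ε(a) c`. -/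
def trivialModule : GrMod 𝒜 :=
  letI m : Module A K := Module.compHom K H.counitHom
  { carrier := K
    module := m
    isScalarTower := ⟨fun c a x => by
      change Coalgebra.counit (R := K) (c • a) * x = c * (Coalgebra.counit (R := K) a * x)
      rw [map_smul, smul_eq_mul, mul_assoc]⟩
    gr := fun g => if g = 0 then ⊤ else ⊥
    internal := by
      refine isInternal_of_proj (fun x => Submodule.mem_iSup_of_mem 0 (by simp))
        (fun g => if g = 0 then LinearMap.id else 0) ?_ ?_
      · intro g x hx
        by_cases hg : g = 0
        · simp [hg]
        · simp only [hg, if_false, Submodule.mem_bot] at hx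
          simp [hx]
      · intro g h hgh x hx
        by_cases hh : h = 0
        · simp [show g ≠ 0 from fun e => hgh (e.trans hh.symm)]
        · simp only [hh, if_false, Submodule.mem_bot] at hx
          simp [hx]
    smul_mem := by
      intro g h a x ha hx
      change Coalgebra.counit (R := K) a * x ∈ _
      by_cases hg : g = 0
      · rw [hg, zero_add]
        exact Submodule.smul_mem _ (Coalgebra.counit (R := K) a) hx
      · rw [H.counit_eq_zero ha hg, zero_mul]
        exact zero_mem _ }

/-- The action `(x ⊗ y) m = χ(|y|, |m|) x.m.S(y)` of `A ⊗ A` on a graded bimodule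
(that is, a graded `A^e`-module) `M`. -/
def adAct (M : GrMod (envGr 𝒜)) : A ⊗[K] A →ₗ[K] M.carrier →ₗ[K] M.carrier :=
  TensorProduct.lift (LinearMap.flip
    (byDegree (P := A →ₗ[K] M.carrier →ₗ[K] M.carrier) (DirectSum.Decomposition.isInternal 𝒜)
      fun k => LinearMap.flip
        (((TensorProduct.mk K A Aᵐᵒᵖ).compl₂
          ((MulOpposite.opLinearEquiv K : A ≃ₗ[K] Aᵐᵒᵖ).toLinearMap ∘ₗ H.antipode)).compr₂
          (LinearMap.lcomp K M.carrier (scale M.internal (χ k)) ∘ₗ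
            (Algebra.lsmul K K M.carrier :
              A ⊗[K] Aᵐᵒᵖ →ₐ[K] Module.End K M.carrier).toLinearMap))))

theorem adAct_tmul (M : GrMod (envGr 𝒜)) {k h : G} {y : A} (hy : y ∈ 𝒜 k) {m : M.carrier}
    (hm : m ∈ M.gr h) (x : A) : H.adAct M (x ⊗ₜ y) m =
      (χ k h : K) • ((x ⊗ₜ[K] MulOpposite.op (H.antipode y)) • m) := by
  rw [adAct, TensorProduct.lift.tmul, LinearMap.flip_apply, byDegree_of_mem _ _ hy]
  simp only [LinearMap.flip_apply, LinearMap.compr₂_apply, LinearMap.compl₂_apply,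
    LinearMap.comp_apply, LinearMap.lcomp_apply, scale_of_mem _ _ hm]
  exact map_smul _ _ _

theorem env_smul_mem (M : GrMod (envGr 𝒜)) {g h k : G} {a b : A} {m : M.carrier}
    (ha : a ∈ 𝒜 g) (hb : b ∈ 𝒜 h) (hm : m ∈ M.gr k) :
    (a ⊗ₜ[K] MulOpposite.op b) • m ∈ M.gr (g + h + k) :=
  M.smul_mem (tmul_mem_tensorGr ha (op_mem_opGr hb)) hm

theorem adAct_mem (M : GrMod (envGr 𝒜)) {g h : G} {z : A ⊗[K] A} (hz : z ∈ tensorGr 𝒜 𝒜 g)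
    {m : M.carrier} (hm : m ∈ M.gr h) : H.adAct M z m ∈ M.gr (g + h) := by
  induction hz using Submodule.span_induction with
  | zero => rw [map_zero, LinearMap.zero_apply]; exact zero_mem _
  | add x y _ _ hx hy => rw [map_add, LinearMap.add_apply]; exact add_mem hx hy
  | smul c x _ hx => rw [map_smul, LinearMap.smul_apply]; exact Submodule.smul_mem _ c hx
  | mem x hx =>
    obtain ⟨k, l, rfl, a, ha, b, hb, rfl⟩ := hx
    rw [H.adAct_tmul M hb hm]
    exact Submodule.smul_mem _ _ (env_smul_mem M ha (H.antipode_mem hb) hm)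

theorem adAct_one (M : GrMod (envGr 𝒜)) (m : M.carrier) : H.adAct M (1 ⊗ₜ 1) m = m := by
  induction m using internal_induction M.internal with
  | zero => rw [map_zero]
  | add x y hx hy => rw [map_add, hx, hy]
  | hom g m hm =>
    rw [H.adAct_tmul M (SetLike.GradedOne.one_mem (A := 𝒜)) hm, χ.zero_left, H.antipode_one,
      Units.val_one, one_smul]
    exact one_smul (A ⊗[K] Aᵐᵒᵖ) m

theorem adAct_twMul (M : GrMod (envGr 𝒜)) (z w : A ⊗[K] A) (m : M.carrier) :
    H.adAct M (twMul χ 𝒜 z w) m = H.adAct M z (H.adAct M w m) := by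
  induction z using TensorProduct.induction_on with
  | zero => simp
  | add x y hx hy => simp only [map_add, LinearMap.add_apply, hx, hy]
  | tmul a a' =>
    induction w using TensorProduct.induction_on with
    | zero => simp
    | add x y hx hy => simp only [map_add, LinearMap.add_apply, hx, hy]
    | tmul b b' =>
      induction a using internal_induction (DirectSum.Decomposition.isInternal 𝒜) with
      | zero => simp
      | add x y hx hy =>
        simp only [TensorProduct.add_tmul, map_add, LinearMap.add_apply, hx, hy]
      | hom ga a ha =>
      induction a' using internal_induction (DirectSum.Decomposition.isInternal 𝒜) with
      | zero => simp
      | add x y hx hy =>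
        simp only [TensorProduct.tmul_add, map_add, LinearMap.add_apply, hx, hy]
      | hom ga' a' ha' =>
      induction b using internal_induction (DirectSum.Decomposition.isInternal 𝒜) with
      | zero => simp
      | add x y hx hy =>
        simp only [TensorProduct.add_tmul, map_add, LinearMap.add_apply, hx, hy]
      | hom gb b hb =>
      induction b' using internal_induction (DirectSum.Decomposition.isInternal 𝒜) with
      | zero => simp
      | add x y hx hy =>
        simp only [TensorProduct.tmul_add, map_add, LinearMap.add_apply, hx, hy]
      | hom gb' b' hb' =>
      induction m using internal_induction M.internal with
      | zero => simp
      | add x y hx hy => simp only [map_add, hx, hy]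
      | hom gm m hm =>
        rw [twMul_tmul χ 𝒜 ha' hb, map_smul, LinearMap.smul_apply,
          H.adAct_tmul M (SetLike.GradedMul.mul_mem ha' hb') hm, H.adAct_tmul M hb' hm, map_smul,
          H.adAct_tmul M ha' (env_smul_mem M hb (H.antipode_mem hb') hm), H.antipode_mul ha' hb',
          smul_smul, MulOpposite.op_smul, TensorProduct.tmul_smul, smul_assoc, smul_smul,
          smul_smul, ← mul_smul, Algebra.TensorProduct.tmul_mul_tmul, ← MulOpposite.op_mul]
        congr 1
        simp only [χ.map_add_left, χ.map_add_right, Units.val_mul]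
        ring

/-- The adjoint module `^{ad}M` of a graded bimodule `M`: the graded space `M` with the action
`a m = ∑ χ(|a₂|, |m|) a₁.m.S(a₂)`. -/
def ad (M : GrMod (envGr 𝒜)) : GrMod 𝒜 :=
  letI m : Module A M.carrier :=
    { smul := fun a m => H.adAct M (Coalgebra.comul a) m
      one_smul := fun m => by
        change H.adAct M (Coalgebra.comul 1) m = m
        rw [H.comul_one, adAct_one]
      mul_smul := fun a b m => by
        change H.adAct M (Coalgebra.comul (a * b)) m = _
        rw [H.comul_mul, adAct_twMul]; rfl
      smul_zero := fun a => map_zero (H.adAct M (Coalgebra.comul a))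
      smul_add := fun a => map_add (H.adAct M (Coalgebra.comul a))
      add_smul := fun a b m => by
        change H.adAct M (Coalgebra.comul (a + b)) m = _
        rw [map_add, map_add]; rfl
      zero_smul := fun m => by
        change H.adAct M (Coalgebra.comul 0) m = 0
        rw [map_zero, map_zero]; rfl }
  { carrier := M.carrier
    module := m
    isScalarTower := ⟨fun c a x => by
      change H.adAct M (Coalgebra.comul (c • a)) x = c • H.adAct M (Coalgebra.comul a) x
      rw [map_smul, map_smul]; rfl⟩
    gr := M.gr
    internal := M.internal
    smul_mem := fun ha hm => H.adAct_mem M (H.comul_mem ha) hm }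

end ColorHopfAlgebra

/-- `HH^n(A, M)_h = EXT^n_{A^e}(A, M)_h`, for a graded `A`-bimodule `M`, regarded as a graded
`A^e`-module. -/
def hochschildDeg (𝒜 : G → Submodule K A) [GradedAlgebra 𝒜] (n : ℕ) (h : G)
    (M : GrMod (envGr 𝒜)) : ModuleCat.{u} K :=
  GrMod.extDeg n h (regular 𝒜) M

theorem ColorHopfAlgebra.ad_smul {χ : Bicharacter K G} {𝒜 : G → Submodule K A}
    [GradedAlgebra 𝒜] [Coalgebra K A] (H : ColorHopfAlgebra χ 𝒜) (M : GrMod (envGr 𝒜)) (a : A)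
    (m : M.carrier) : (a • (show (H.ad M).carrier from m) : (H.ad M).carrier) =
      (H.adAct M (Coalgebra.comul a) m : M.carrier) := rfl

end Cohomology

end ColorHopf

end

open ColorHopf CategoryTheory

/-! The group is written additively. The heart of the proof is an adjunction. For a graded
`A`-module `X`, the space `X ⊗ A` is a graded bimodule: the left action goes through `Δ` with the
factor `χ(|a₂|, |x|)`, and the right action is multiplication on the second factor. This induction
functor is left adjoint to `N ↦ ^{ad}N`. A graded `A`-linear map `f : X → ^{ad}N` extends to `x ⊗ b
↦ f(x).b`, and a bimodule map out of `X ⊗ A` restricts along `x ↦ x ⊗ 1`. That the extension is left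
linear is `sum_biAct_adAct`, which rests on `∑ S(a₁) a₂ = ε(a)`. That the restriction is linear for
the adjoint action is `sum_twAct_antipode`, which rests on `∑ a₁ S(a₂) = ε(a)`. The color factors
cause no trouble: `S` preserves degrees and `χ` is multiplicative in its first variable, so the
factors of the pieces of `Δ(a)` merge into the factor of their product. That product is a scalar, of
degree `0`, where the factor is `1`.

For `X = 𝕂` the induced bimodule is `A` itself (`isIso_regularToInd`). Since `HOM(X, -)_h = Hom(X,
-[h])`, this gives `HOM_{A^e}(A, M)_h ≅ Hom_{A-gr}(𝕂, ^{ad}(M[h]))`, naturally in `M`.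

To pass to derived functors, it is enough that `E : M ↦ ^{ad}(M[h])` be exact and preserve
injectives (`rightDerivedObjIso`), because it then carries injective resolutions to injective
resolutions. Exactness is clear: `E` leaves the underlying sets and maps alone. Shifts preserve
injectives because they are invertible; `ad` does because its left adjoint `- ⊗ A` preserves
monomorphisms, `A` being flat over the field `𝕂`.

The same principle for the shift alone gives `EXT^n_A(X, Y)_h ≅ Ext^n_{A-gr}(X, Y[h])`. The second
isomorphism is the case `Y = (^{ad}(M[h]))[-h]`. The last one is the case `Y = ^{ad}M`, because
`χ(-, h) = 1` makes the adjoint action insensitive to the shift by `h` (`adAct_shift`). -/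

namespace CategoryTheory.Functor

/-! ### Derived functors along an exact functor preserving injectives -/

open Limits

universe v₁ v₂ v₃ u₁ u₂ u₃

/-- An additive functor which preserves homology and injective objects sends an injective
resolution of `Z` to an injective resolution of `E.obj Z`. -/
noncomputable def mapInjRes {C : Type u₁} [Category.{v₁} C]
    {D : Type u₂} [Category.{v₂} D] [Abelian C] [Abelian D] (E : C ⥤ D) [E.Additive]
    [E.PreservesInjectiveObjects] [E.PreservesHomology] {Z : C} (I : InjectiveResolution Z) :
    InjectiveResolution (E.obj Z) where
  cocomplex := (E.mapHomologicalComplex _).obj I.cocomplex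
  injective n := PreservesInjectiveObjects.injective_obj (I.injective n)
  -- The augmentation has to start at the complex concentrated on `E.obj Z`, which is first
  -- identified with the image under `E` of the complex concentrated on `Z`. Exactness of `E` keeps
  -- the result a quasi-isomorphism.
  ι := (HomologicalComplex.singleMapHomologicalComplex _ _ _).inv.app _ ≫
    (E.mapHomologicalComplex _).map I.ι
  quasiIso := inferInstance

/-- Right derived functors along an exact functor `E` preserving injective objects: if
`F' ≅ E ⋙ F`, then `R^n F' (X) ≅ R^n F (E X)`. -/
noncomputable def rightDerivedObjIso {C : Type u₁} [Category.{v₁} C]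
    {D : Type u₂} [Category.{v₂} D] {B : Type u₃} [Category.{v₃} B]
    [Abelian C] [Abelian D] [Abelian B] [HasInjectiveResolutions C] [HasInjectiveResolutions D]
    (E : C ⥤ D) [E.Additive] [E.PreservesInjectiveObjects] [E.PreservesHomology]
    {F' : C ⥤ B} {F : D ⥤ B} [F'.Additive] [F.Additive] (α : F' ≅ E ⋙ F) (n : ℕ) (X : C) :
    (F'.rightDerived n).obj X ≅ (F.rightDerived n).obj (E.obj X) :=
  let I := injectiveResolution X
  -- A single resolution `I` serves both sides: `F'` is computed on `I` and `F` on `E(I)`, and `α`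
  -- identifies the complexes `F'(I)` and `F(E(I))`.
  I.isoRightDerivedObj F' n ≪≫
    (HomologicalComplex.homologyFunctor B _ n).mapIso
      ((NatIso.mapHomologicalComplex α (ComplexShape.up ℕ)).app I.cocomplex) ≪≫
    ((E.mapInjRes I).isoRightDerivedObj F n).symm

end CategoryTheory.Functor

/-! ### Exactness in categories of graded modules -/

namespace ColorHopf.GrMod

open scoped TensorProduct
open Limits

section

variable {K : Type u} [Field K] {G : Type u} [AddCommGroup G] [DecidableEq G]
variable {A : Type u} [Ring A] [Algebra K A] {𝒜 : G → Submodule K A}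
variable {B : Type u} [Ring B] [Algebra K B] {ℬ : G → Submodule K B}

/-- Exactness means that the composite from the kernel of `S.g` to the cokernel of `S.f` vanishes,
and the explicit kernel and cokernel are those of the underlying modules. Hence exactness can be
tested on elements, without regard to the grading or the action. -/
theorem exact_iff (S : ShortComplex (GrMod 𝒜)) :
    S.Exact ↔ ∀ x, lin S.g x = 0 → ∃ y, lin S.f y = x := by
  rw [S.exact_iff_of_forks
    (isLimitOfInj (kerι S.g) Subtype.val_injective S.g (kerι_comp S.g) (fun n hn => ⟨⟨n, hn⟩, rfl⟩))
    (isColimitOfSurj (cokerπ S.f) (Submodule.mkQ_surjective _) S.f (comp_cokerπ S.f)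
      (fun _ hn => cokerπ_eq_zero S.f hn))]
  change kerι S.g ≫ cokerπ S.f = 0 ↔ _
  constructor
  · intro h x hx
    exact cokerπ_eq_zero S.f (congrArg (fun k => lin k (⟨x, hx⟩ : LinearMap.ker (lin S.g))) h)
  · intro h
    ext x
    obtain ⟨y, hy⟩ := h x.1 x.2
    change (LinearMap.range (lin S.f)).mkQ x.1 = 0
    rw [Submodule.mkQ_apply, Submodule.Quotient.mk_eq_zero]
    exact ⟨y, hy⟩

/-- A functor between categories of graded modules that does not change the underlying sets and
functions preserves homology. -/
theorem preservesHomology_of_bijective (E : GrMod 𝒜 ⥤ GrMod ℬ) [E.Additive]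
    (e : ∀ M : GrMod 𝒜, M.carrier ≃+ (E.obj M).carrier)
    (he : ∀ {M N : GrMod 𝒜} (f : M ⟶ N) (m : M.carrier), lin (E.map f) (e M m) = e N (lin f m)) :
    E.PreservesHomology := by
  refine Functor.preservesHomology_of_map_exact E fun S hS => ?_
  rw [exact_iff] at hS ⊢
  intro x hx
  obtain ⟨x, rfl⟩ := (e _).surjective x
  have hx' : e S.X₃ (lin S.g x) = 0 := (he S.g x).symm.trans hx
  obtain ⟨y, rfl⟩ := hS x ((e _).map_eq_zero_iff.1 hx')
  exact ⟨e _ y, he S.f y⟩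

end

/-! ### Shifts, and `EXT` as `Ext` into a shifted module -/

section Shift

variable {K : Type u} [Field K] {G : Type u} [AddCommGroup G] [DecidableEq G]
variable {A : Type u} [Ring A] [Algebra K A] {𝒜 : G → Submodule K A}

/-- The shift as a functor. -/
def shiftFunctor (𝒜 : G → Submodule K A) (h : G) : GrMod 𝒜 ⥤ GrMod 𝒜 where
  obj M := shift h M
  map {M N} f := mkHom (M := shift h M) (N := shift h N) (lin (M := M) (N := N) f)
    (fun _ _ hm => lin_mem (M := M) (N := N) f hm)
  map_id _ := rfl
  map_comp _ _ := rfl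

instance (h : G) : (shiftFunctor 𝒜 h).Additive where
  map_add := rfl

instance (h : G) : (shiftFunctor 𝒜 h).PreservesHomology :=
  preservesHomology_of_bijective (shiftFunctor 𝒜 h) (fun M => AddEquiv.refl M.carrier)
    (fun _ _ => rfl)

/-- Shifting by `-h` undoes shifting by `h` and keeps injective maps injective. An extension problem
into `J[h]` therefore becomes one into `J`, with the same underlying maps. Only the degrees have to
be rewritten. -/
instance (h : G) : (shiftFunctor 𝒜 h).PreservesInjectiveObjects where
  injective_obj {J} hJ := ⟨fun {X Y} g f hf => by
    let f' : shift (-h) X ⟶ shift (-h) Y := (shiftFunctor 𝒜 (-h)).map f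
    have : Mono f' := mono_of_injective f' (injective_of_mono f)
    let g' : shift (-h) X ⟶ J := mkHom (M := shift (-h) X) (N := J)
        (lin (M := X) (N := shift h J) g) fun k m hm => by
      have := lin_mem (M := X) (N := shift h J) g (g := -h + k) hm
      change _ ∈ J.gr (h + (-h + k)) at this
      rwa [add_neg_cancel_left] at this
    refine ⟨mkHom (M := Y) (N := shift h J)
      (lin (M := shift (-h) Y) (N := J) (Injective.factorThru g' f')) fun k m hm => ?_, ?_⟩
    · refine lin_mem (M := shift (-h) Y) (N := J) (Injective.factorThru g' f') (g := h + k) ?_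
      change m ∈ Y.gr (-h + (h + k))
      rwa [neg_add_cancel_left]
    · apply hom_ext
      intro x
      exact congrArg (fun k : shift (-h) X ⟶ J => lin k x) (Injective.comp_factorThru g' f')⟩

/-- `HOM_A(X, Y)_h = Hom_{A-gr}(X, Y[h])`. -/
def homDegEquiv (h : G) (X Y : GrMod 𝒜) : homDeg h X Y ≃ₗ[K] (X ⟶ shift h Y) where
  toFun f := mkHom (M := X) (N := shift h Y) f.1 fun g m hm => by
    -- `HOM(X, -)_h` adds `h` on the right of the degree and the shift adds it on the left;
    -- commutativity of `G` makes them agree.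
    change f.1 m ∈ Y.gr (h + g)
    rw [add_comm]
    exact f.2 g m hm
  invFun f := ⟨lin (M := X) (N := shift h Y) f, fun g m hm => by
    rw [add_comm]
    exact lin_mem (M := X) (N := shift h Y) f hm⟩
  map_add' _ _ := rfl
  map_smul' _ _ := rfl
  left_inv _ := rfl
  right_inv _ := rfl

/-- `HOM_A(X, -)_h = Hom_{A-gr}(X, -[h])`. -/
def homDegFunctorIso (h : G) (X : GrMod 𝒜) :
    homDegFunctor h X ≅
      shiftFunctor 𝒜 h ⋙ (linearCoyoneda K (GrMod 𝒜)).obj (Opposite.op X) :=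
  NatIso.ofComponents (fun Y => (homDegEquiv h X Y).toModuleIso) (fun _ => rfl)

/-- `EXT^n_A(X, Y)_h ≅ Ext^n_{A-gr}(X, Y[h])`. -/
noncomputable def extDegIso [GradedAlgebra 𝒜] (n : ℕ) (h : G) (X Y : GrMod 𝒜) :
    extDeg n h X Y ≅ grExt n X (shift h Y) :=
  (shiftFunctor 𝒜 h).rightDerivedObjIso (homDegFunctorIso h X) n Y

/-- Isomorphic arguments have isomorphic `Ext`. -/
noncomputable def grExtIsoOfIso [GradedAlgebra 𝒜] (n : ℕ) (X : GrMod 𝒜) {Y Z : GrMod 𝒜}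
    (e : Y ≅ Z) : grExt n X Y ≅ grExt n X Z :=
  (((linearCoyoneda K (GrMod 𝒜)).obj (Opposite.op X)).rightDerived n).mapIso e

/-- `Y[-h][h] ≅ Y`. -/
def shiftNegShift (h : G) (Y : GrMod 𝒜) : shift h (shift (-h) Y) ≅ Y where
  hom := mkHom (M := shift h (shift (-h) Y)) (N := Y) LinearMap.id fun g m hm => by
    change m ∈ Y.gr (-h + (h + g)) at hm
    rwa [neg_add_cancel_left] at hm
  inv := mkHom (M := Y) (N := shift h (shift (-h) Y)) LinearMap.id fun g m hm => by
    change m ∈ Y.gr (-h + (h + g))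
    rwa [neg_add_cancel_left]
  hom_inv_id := rfl
  inv_hom_id := rfl

end Shift

end ColorHopf.GrMod

/-! ### Sums over iterated coproducts, and bimodule actions -/

namespace ColorHopf.ColorHopfAlgebra

set_option linter.unusedSectionVars false

open scoped TensorProduct
open GrMod Limits

variable {K : Type u} [Field K] {G : Type u} [AddCommGroup G] [DecidableEq G]
variable {A : Type u} [Ring A] [Algebra K A]

theorem _root_.ColorHopf.Bicharacter.zero_right (χ : Bicharacter K G) (k : G) : χ k 0 = 1 := by
  have := χ.map_add_right k 0 0
  rw [add_zero] at this
  exact left_eq_mul.1 this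

/-- This is the Sweedler computation shared by both adjunction identities. By `h₁`, `T(Δ a)` is `T₀`
at `∑ a₁ ⊗ a₂ ⊗ a₃` bracketed to the left. Coassociativity brackets it to the right, `h₂` collapses
the last two legs to a counit, and the counit axiom leaves `W a`. -/
theorem _root_.Coalgebra.apply_comul_of_coassoc {P : Type u} [AddCommGroup P] [Module K P]
    [Coalgebra K A] (T : A ⊗[K] A →ₗ[K] P) (T₀ : (A ⊗[K] A) ⊗[K] A →ₗ[K] P) (W : A →ₗ[K] P)
    (h₁ : ∀ y z : A, T (y ⊗ₜ z) = T₀ (Coalgebra.comul y ⊗ₜ z))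
    (h₂ : ∀ p q : A, T₀ ((TensorProduct.assoc K A A A).symm (p ⊗ₜ Coalgebra.comul q)) =
      (Coalgebra.counit q : K) • W p) (a : A) : T (Coalgebra.comul a) = W a := by
  have e₁ : T = T₀ ∘ₗ (Coalgebra.comul (R := K) (A := A)).rTensor A :=
    TensorProduct.ext' fun y z => h₁ y z
  have e₂ : T₀ ∘ₗ (TensorProduct.assoc K A A A).symm.toLinearMap ∘ₗ
      (Coalgebra.comul (R := K) (A := A)).lTensor A =
      W ∘ₗ (TensorProduct.rid K A).toLinearMap ∘ₗ
        (Coalgebra.counit (R := K) (A := A)).lTensor A :=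
    TensorProduct.ext' fun p q => by
      simp only [LinearMap.comp_apply, LinearMap.lTensor_tmul, LinearEquiv.coe_coe,
        TensorProduct.rid_tmul, map_smul]
      exact h₂ p q
  rw [e₁, LinearMap.comp_apply, ← Coalgebra.coassoc_symm_apply]
  refine (LinearMap.congr_fun e₂ (Coalgebra.comul a)).trans ?_
  rw [LinearMap.comp_apply, LinearMap.comp_apply, Coalgebra.lTensor_counit_comul]
  simp

section Bimodule

variable {𝒜 : G → Submodule K A} [GradedAlgebra 𝒜]

/-- The action `(a, b, n) ↦ a.n.b` on a graded bimodule. -/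
noncomputable def biAct (N : GrMod (envGr 𝒜)) : A →ₗ[K] A →ₗ[K] N.carrier →ₗ[K] N.carrier :=
  ((TensorProduct.mk K A Aᵐᵒᵖ).compl₂
    (MulOpposite.opLinearEquiv K : A ≃ₗ[K] Aᵐᵒᵖ).toLinearMap).compr₂
    (Algebra.lsmul K K N.carrier : A ⊗[K] Aᵐᵒᵖ →ₐ[K] Module.End K N.carrier).toLinearMap

theorem biAct_apply (N : GrMod (envGr 𝒜)) (a b : A) (n : N.carrier) :
    biAct N a b n = (a ⊗ₜ[K] MulOpposite.op b) • n := rfl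

theorem biAct_biAct (N : GrMod (envGr 𝒜)) (a b c d : A) (n : N.carrier) :
    biAct N a b (biAct N c d n) = biAct N (a * c) (d * b) n := by
  rw [biAct_apply, biAct_apply, biAct_apply, ← mul_smul, Algebra.TensorProduct.tmul_mul_tmul,
    MulOpposite.op_mul]

theorem biAct_one (N : GrMod (envGr 𝒜)) (n : N.carrier) : biAct N 1 1 n = n :=
  one_smul (A ⊗[K] Aᵐᵒᵖ) n

theorem biAct_mem (N : GrMod (envGr 𝒜)) {g h k : G} {a b : A} {n : N.carrier}
    (ha : a ∈ 𝒜 g) (hb : b ∈ 𝒜 h) (hn : n ∈ N.gr k) : biAct N a b n ∈ N.gr (g + h + k) :=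
  N.smul_mem (tmul_mem_tensorGr ha (op_mem_opGr hb)) hn

/-- A linear map between bimodules that commutes with the actions of pure tensors. -/
noncomputable def bilinMk {N P : GrMod (envGr 𝒜)} (f : N.carrier →ₗ[K] P.carrier)
    (hf : ∀ a b n, f (biAct N a b n) = biAct P a b (f n)) :
    N.carrier →ₗ[A ⊗[K] Aᵐᵒᵖ] P.carrier :=
  { f with
    map_smul' := fun z n => by
      change f (z • n) = z • f n
      induction z using TensorProduct.induction_on with
      | zero =>
        exact (congrArg f (zero_smul (A ⊗[K] Aᵐᵒᵖ) n)).trans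
          ((map_zero f).trans (zero_smul (A ⊗[K] Aᵐᵒᵖ) (f n)).symm)
      | add x y hx hy => rw [add_smul, add_smul, map_add, hx, hy]
      | tmul a b => exact hf a b.unop n }

/-- Scalars have degree `0` and `χ(0, k) = 1`. This is how the color factor disappears once an
antipode axiom has produced `ε(q) 1`. -/
theorem scale_algebraMap (χ : Bicharacter K G) (k : G) (c : K) :
    scale (DirectSum.Decomposition.isInternal 𝒜) (fun g => χ g k) (algebraMap K A c) =
      algebraMap K A c := by
  have h0 : algebraMap K A c ∈ 𝒜 0 := by
    rw [Algebra.algebraMap_eq_smul_one]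
    exact Submodule.smul_mem _ c SetLike.GradedOne.one_mem
  rw [scale_of_mem _ _ h0, χ.zero_left, Units.val_one, one_smul]

end Bimodule

variable {χ : Bicharacter K G} {𝒜 : G → Submodule K A} [GradedAlgebra 𝒜] [Coalgebra K A]

/-! ### The twisted action of `(A ⊗ A)^χ` on `X ⊗ A` -/

section Twisted

variable (χ)

/-- The action `(a ⊗ a') (x ⊗ b) = χ(|a'|, |x|) a x ⊗ a' b` of `(A ⊗ A)^χ` on `X ⊗ A`. -/
noncomputable def twAct (X : GrMod 𝒜) :
    A ⊗[K] A →ₗ[K] X.carrier ⊗[K] A →ₗ[K] X.carrier ⊗[K] A :=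
  -- The factor `χ(|a'|, |x|)` depends on two degrees: `byDegree` splits according to `|a'|`, and
  -- for each fixed `|a'|` the dependence on `|x|` is the linear operator `scale` on `X`.
  TensorProduct.lift (LinearMap.flip
    (byDegree (P := A →ₗ[K] X.carrier ⊗[K] A →ₗ[K] X.carrier ⊗[K] A)
      (DirectSum.Decomposition.isInternal 𝒜)
      fun k => LinearMap.flip
        ((TensorProduct.mapBilinear (RingHom.id K) X.carrier A X.carrier A).compl₁₂
          (LinearMap.lcomp K X.carrier (scale X.internal (χ k)) ∘ₗ
            (Algebra.lsmul K K X.carrier : A →ₐ[K] Module.End K X.carrier).toLinearMap)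
          (LinearMap.mul K A))))

theorem twAct_tmul (X : GrMod 𝒜) {h k : G} {a' : A} {x : X.carrier} (ha' : a' ∈ 𝒜 h)
    (hx : x ∈ X.gr k) (a b : A) :
    twAct χ X (a ⊗ₜ a') (x ⊗ₜ b) = (χ h k : K) • ((a • x) ⊗ₜ[K] (a' * b)) := by
  rw [twAct, TensorProduct.lift.tmul, LinearMap.flip_apply, byDegree_of_mem _ _ ha']
  simp only [LinearMap.flip_apply, LinearMap.compl₁₂_apply, LinearMap.comp_apply,
    TensorProduct.mapBilinear_apply, TensorProduct.map_tmul, LinearMap.lcomp_apply,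
    scale_of_mem _ _ hx, TensorProduct.smul_tmul', LinearMap.mul_apply']
  congr 1
  exact map_smul _ _ _

/-- On homogeneous tensors both sides carry the factor `χ(|a'|, |b|) χ(|a'|, |x|) χ(|b'|, |x|)`, by
multiplicativity of `χ` in each variable. Since `Δ` is multiplicative into `(A ⊗ A)^χ`, this makes
`X ⊗ A` a left `A`-module. -/
theorem twAct_twMul (X : GrMod 𝒜) (z w : A ⊗[K] A) (v : X.carrier ⊗[K] A) :
    twAct χ X (twMul χ 𝒜 z w) v = twAct χ X z (twAct χ X w v) := by
  induction z using TensorProduct.induction_on with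
  | zero => simp
  | add x y hx hy => simp only [map_add, LinearMap.add_apply, hx, hy]
  | tmul a a' =>
    induction w using TensorProduct.induction_on with
    | zero => simp
    | add x y hx hy => simp only [map_add, LinearMap.add_apply, hx, hy]
    | tmul b b' =>
      induction v using TensorProduct.induction_on with
      | zero => simp
      | add x y hx hy => simp only [map_add, hx, hy]
      | tmul x c =>
      induction a' using internal_induction (DirectSum.Decomposition.isInternal 𝒜) with
      | zero => simp
      | add x y hx hy =>
        simp only [TensorProduct.tmul_add, map_add, LinearMap.add_apply, hx, hy]
      | hom ga' a' ha' =>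
      induction b using internal_induction (DirectSum.Decomposition.isInternal 𝒜) with
      | zero => simp
      | add x y hx hy =>
        simp only [TensorProduct.add_tmul, map_add, LinearMap.add_apply, hx, hy]
      | hom gb b hb =>
      induction b' using internal_induction (DirectSum.Decomposition.isInternal 𝒜) with
      | zero => simp
      | add x y hx hy =>
        simp only [TensorProduct.tmul_add, map_add, LinearMap.add_apply, hx, hy]
      | hom gb' b' hb' =>
      induction x using internal_induction X.internal with
      | zero => simp
      | add x y hx hy => simp only [TensorProduct.add_tmul, map_add, hx, hy]
      | hom gx x hx =>
        rw [twMul_tmul χ 𝒜 ha' hb, map_smul, LinearMap.smul_apply,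
          twAct_tmul χ X (SetLike.GradedMul.mul_mem ha' hb') hx, twAct_tmul χ X hb' hx, map_smul,
          twAct_tmul χ X ha' (X.smul_mem hb hx)]
        simp only [smul_smul, mul_assoc a']
        congr 1
        simp only [χ.map_add_left, χ.map_add_right, Units.val_mul]
        ring

theorem twAct_one (X : GrMod 𝒜) (v : X.carrier ⊗[K] A) : twAct χ X (1 ⊗ₜ 1) v = v := by
  induction v using TensorProduct.induction_on with
  | zero => simp
  | add x y hx hy => simp only [map_add, hx, hy]
  | tmul x c =>
  induction x using internal_induction X.internal with
  | zero => simp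
  | add x y hx hy => simp only [TensorProduct.add_tmul, map_add, hx, hy]
  | hom gx x hx =>
    rw [twAct_tmul χ X (SetLike.GradedOne.one_mem (A := 𝒜)) hx, χ.zero_left, Units.val_one,
      one_smul, one_smul, one_mul]

theorem twAct_mem (X : GrMod 𝒜) {g k : G} {z : A ⊗[K] A} (hz : z ∈ tensorGr 𝒜 𝒜 g)
    {v : X.carrier ⊗[K] A} (hv : v ∈ tensorGr X.gr 𝒜 k) :
    twAct χ X z v ∈ tensorGr X.gr 𝒜 (g + k) := by
  induction hz using Submodule.span_induction with
  | zero => rw [map_zero, LinearMap.zero_apply]; exact zero_mem _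
  | add x y _ _ hx hy => rw [map_add, LinearMap.add_apply]; exact add_mem hx hy
  | smul c x _ hx => rw [map_smul, LinearMap.smul_apply]; exact Submodule.smul_mem _ c hx
  | mem x hx =>
    obtain ⟨g, g', rfl, a, ha, a', ha', rfl⟩ := hx
    induction hv using Submodule.span_induction with
    | zero => rw [map_zero]; exact zero_mem _
    | add x y _ _ hx hy => rw [map_add]; exact add_mem hx hy
    | smul c x _ hx => rw [map_smul]; exact Submodule.smul_mem _ c hx
    | mem y hy =>
      obtain ⟨k, k', rfl, x, hx, b, hb, rfl⟩ := hy
      rw [twAct_tmul χ X ha' hx, show g + g' + (k + k') = g + k + (g' + k') by abel]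
      exact Submodule.smul_mem _ _
        (tmul_mem_tensorGr (X.smul_mem ha hx) (SetLike.GradedMul.mul_mem ha' hb))

/-- Right multiplication commutes with the twisted action. -/
theorem twAct_lTensor_mulRight (X : GrMod 𝒜) (z : A ⊗[K] A) (c : A) (v : X.carrier ⊗[K] A) :
    twAct χ X z ((LinearMap.mulRight K c).lTensor X.carrier v) =
      (LinearMap.mulRight K c).lTensor X.carrier (twAct χ X z v) := by
  induction z using TensorProduct.induction_on with
  | zero => simp
  | add x y hx hy => simp only [map_add, LinearMap.add_apply, hx, hy]
  | tmul a a' =>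
  induction v using TensorProduct.induction_on with
  | zero => simp
  | add x y hx hy => simp only [map_add, hx, hy]
  | tmul x b =>
  induction a' using internal_induction (DirectSum.Decomposition.isInternal 𝒜) with
  | zero => simp
  | add x y hx hy => simp only [TensorProduct.tmul_add, map_add, LinearMap.add_apply, hx, hy]
  | hom ga' a' ha' =>
  induction x using internal_induction X.internal with
  | zero => simp
  | add x y hx hy => simp only [TensorProduct.add_tmul, map_add, hx, hy]
  | hom gx x hx =>
    -- The factor sees only `|a'|` and `|x|`, never the degree of `b` or `c`, so what remains is
    -- associativity in `A`.
    rw [LinearMap.lTensor_tmul, twAct_tmul χ X ha' hx, twAct_tmul χ X ha' hx, map_smul,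
      LinearMap.lTensor_tmul, LinearMap.mulRight_apply, LinearMap.mulRight_apply, mul_assoc]

end Twisted

variable (H : ColorHopfAlgebra χ 𝒜)

/-! ### The induced bimodule `X ⊗ A` -/

/-- The left action of `A` on `X ⊗ A`, `a (x ⊗ b) = ∑ χ(|a₂|, |x|) a₁ x ⊗ a₂ b`. -/
noncomputable def indLeft (X : GrMod 𝒜) : A →ₐ[K] Module.End K (X.carrier ⊗[K] A) :=
  AlgHom.ofLinearMap (twAct χ X ∘ₗ Coalgebra.comul)
    (LinearMap.ext fun v => by
      rw [LinearMap.comp_apply, H.comul_one, twAct_one]; rfl)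
    (fun a b => LinearMap.ext fun v => by
      rw [LinearMap.comp_apply, H.comul_mul, twAct_twMul]; rfl)

/-- The right action of `A` on `X ⊗ A`. -/
noncomputable def indRight (X : GrMod 𝒜) : Aᵐᵒᵖ →ₐ[K] Module.End K (X.carrier ⊗[K] A) :=
  AlgHom.ofLinearMap
    ((LinearMap.lTensorHom X.carrier) ∘ₗ (LinearMap.mul K A).flip ∘ₗ
      (MulOpposite.opLinearEquiv K : A ≃ₗ[K] Aᵐᵒᵖ).symm.toLinearMap)
    (by ext x b; simp)
    (fun a b => by ext x c; simp [mul_assoc])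

theorem commute_indLeft_indRight (X : GrMod 𝒜) (a : A) (b : Aᵐᵒᵖ) :
    Commute (H.indLeft X a) (indRight X b) :=
  LinearMap.ext fun v => twAct_lTensor_mulRight χ X (Coalgebra.comul a) b.unop v

/-- The action of `A^e` on `X ⊗ A`. -/
noncomputable def indHom (X : GrMod 𝒜) : A ⊗[K] Aᵐᵒᵖ →ₐ[K] Module.End K (X.carrier ⊗[K] A) :=
  Algebra.TensorProduct.lift (H.indLeft X) (indRight X) (H.commute_indLeft_indRight X)

theorem indHom_tmul (X : GrMod 𝒜) (a c : A) (x : X.carrier) (b : A) :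
    H.indHom X (a ⊗ₜ MulOpposite.op c) (x ⊗ₜ b) =
      twAct χ X (Coalgebra.comul a) (x ⊗ₜ (b * c)) := by
  rw [indHom, Algebra.TensorProduct.lift_tmul]
  rfl

/-- The graded bimodule `X ⊗ A` induced from a graded module `X`. -/
noncomputable def ind (X : GrMod 𝒜) : GrMod (envGr 𝒜) :=
  letI m : Module (A ⊗[K] Aᵐᵒᵖ) (X.carrier ⊗[K] A) :=
    Module.compHom _ (H.indHom X).toRingHom
  { carrier := X.carrier ⊗[K] A
    module := m
    isScalarTower := ⟨fun c z v => by
      change H.indHom X (c • z) v = c • H.indHom X z v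
      rw [map_smul]; rfl⟩
    gr := tensorGr X.gr 𝒜
    internal := tensorGr_internal X.internal (DirectSum.Decomposition.isInternal 𝒜)
    smul_mem := by
      intro g k z v hz hv
      change H.indHom X z v ∈ tensorGr X.gr 𝒜 (g + k)
      have hz' : z ∈ tensorGr 𝒜 (opGr 𝒜) g := hz
      clear hz
      induction hz' using Submodule.span_induction with
      | zero => rw [map_zero, LinearMap.zero_apply]; exact zero_mem _
      | add x y _ _ hx hy => rw [map_add, LinearMap.add_apply]; exact add_mem hx hy
      | smul c x _ hx => rw [map_smul, LinearMap.smul_apply]; exact Submodule.smul_mem _ c hx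
      | mem z hz =>
        obtain ⟨g, g', rfl, a, ha, _, ⟨c, hc, rfl⟩, rfl⟩ := hz
        induction hv using Submodule.span_induction with
        | zero => rw [map_zero]; exact zero_mem _
        | add x y _ _ hx hy => rw [map_add]; exact add_mem hx hy
        | smul c x _ hx => rw [map_smul]; exact Submodule.smul_mem _ c hx
        | mem y hy =>
          obtain ⟨k, k', rfl, x, hx, b, hb, rfl⟩ := hy
          change H.indHom X (a ⊗ₜ MulOpposite.op c) _ ∈ _
          rw [indHom_tmul, show g + g' + (k + k') = g + (k + (k' + g')) by abel]
          exact twAct_mem χ X (H.comul_mem ha)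
            (tmul_mem_tensorGr hx (SetLike.GradedMul.mul_mem hb hc)) }

theorem ind_smul (X : GrMod 𝒜) (a c : A) (x : X.carrier) (b : A) :
    ((a ⊗ₜ[K] MulOpposite.op c) • (show (H.ind X).carrier from x ⊗ₜ[K] b) : (H.ind X).carrier) =
      (twAct χ X (Coalgebra.comul a) (x ⊗ₜ (b * c)) : X.carrier ⊗[K] A) :=
  H.indHom_tmul X a c x b

/-! ### The two antipode identities behind the adjunction -/

theorem adAct_tmul_biAct (N : GrMod (envGr 𝒜)) {k h : G} {y : A} (hy : y ∈ 𝒜 k)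
    {n : N.carrier} (hn : n ∈ N.gr h) (x : A) :
    H.adAct N (x ⊗ₜ y) n = (χ k h : K) • biAct N x (H.antipode y) n :=
  H.adAct_tmul N hy hn x

/-- `∑ χ(|a₂|, |n|) (a₁ · n) . a₂ b = a . n . b` in a graded bimodule. -/
theorem sum_biAct_adAct (N : GrMod (envGr 𝒜)) {k : G} {n : N.carrier} (hn : n ∈ N.gr k)
    (b : A) (T : A ⊗[K] A →ₗ[K] N.carrier)
    (hT : ∀ (y z : A) (g : G), z ∈ 𝒜 g → T (y ⊗ₜ z) =
      (χ g k : K) • biAct N 1 (z * b) (H.adAct N (Coalgebra.comul y) n)) (a : A) :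
    T (Coalgebra.comul a) = biAct N a b n := by
  -- The degree `k` of `n` is fixed, so the factor `χ(|z|, k)` is a linear operator in `z`. This
  -- makes `T₀` linear on all tensors, although `hT` describes `T` only for homogeneous `z`.
  let t : A →ₗ[K] A := scale (DirectSum.Decomposition.isInternal 𝒜) (fun g => χ g k)
  let T₀ : (A ⊗[K] A) ⊗[K] A →ₗ[K] N.carrier := TensorProduct.lift
    (((biAct N 1 ∘ₗ LinearMap.mulRight K b ∘ₗ t).flip) ∘ₗ (H.adAct N).flip n)
  have hT₀ : ∀ (u : A ⊗[K] A) (z : A),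
      T₀ (u ⊗ₜ z) = biAct N 1 (t z * b) (H.adAct N u n) := fun _ _ => rfl
  refine Coalgebra.apply_comul_of_coassoc T T₀ ((biAct N).flip b |>.flip n) ?_ ?_ a
  · intro y z
    rw [hT₀]
    induction z using internal_induction (DirectSum.Decomposition.isInternal 𝒜) with
    | zero => simp
    | add z z' hz hz' =>
      simp only [TensorProduct.tmul_add, map_add, add_mul, LinearMap.add_apply, hz, hz']
    | hom g z hz =>
      rw [hT y z g hz, scale_of_mem _ _ hz, smul_mul_assoc, map_smul, LinearMap.smul_apply]
  · intro p q
    -- For `w = y ⊗ z` the adjoint action contributes `χ(|y|, k)` and `t` contributes `χ(|z|, k)`.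
    -- Their product is the factor of `S(y) z`, because `S` preserves degrees. Taking `w = Δ(q)`
    -- then gives `∑ S(q₁) q₂ = ε(q) 1`.
    have key : ∀ w : A ⊗[K] A, T₀ ((TensorProduct.assoc K A A A).symm (p ⊗ₜ w)) =
        biAct N p (t (H.leftMul w) * b) n := by
      intro w
      induction w using TensorProduct.induction_on with
      | zero => simp
      | add x y hx hy =>
        simp only [TensorProduct.tmul_add, map_add, add_mul, LinearMap.add_apply, hx, hy]
      | tmul y z =>
        rw [TensorProduct.assoc_symm_tmul, hT₀, leftMul_tmul]
        induction y using internal_induction (DirectSum.Decomposition.isInternal 𝒜) with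
        | zero => simp
        | add y y' hy hy' =>
          simp only [TensorProduct.tmul_add, map_add, add_mul, LinearMap.add_apply, hy, hy']
        | hom h y hy =>
          induction z using internal_induction (DirectSum.Decomposition.isInternal 𝒜) with
          | zero => simp
          | add z z' hz hz' =>
            simp only [map_add, mul_add, add_mul, LinearMap.add_apply, hz, hz']
          | hom g z hz =>
            rw [H.adAct_tmul_biAct N hy hn, map_smul, biAct_biAct, scale_of_mem _ _ hz,
              scale_of_mem _ _ (SetLike.GradedMul.mul_mem (H.antipode_mem hy) hz)]
            simp only [smul_mul_assoc, mul_smul_comm, map_smul, LinearMap.smul_apply, smul_smul,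
              χ.map_add_left, Units.val_mul, one_mul, mul_assoc]
    rw [key, show H.leftMul (Coalgebra.comul q) = _ from H.mul_rTensor_comul q, scale_algebraMap,
      ← Algebra.smul_def, map_smul, LinearMap.smul_apply]
    rfl

/-- `∑ a₁ (x ⊗ S(a₂)) = a x ⊗ 1`, up to the factor `χ(|a₂|, |x|)`, in `X ⊗ A`. -/
theorem sum_twAct_antipode (X : GrMod 𝒜) {k : G} {x : X.carrier} (hx : x ∈ X.gr k)
    (T : A ⊗[K] A →ₗ[K] X.carrier ⊗[K] A)
    (hT : ∀ (y z : A) (g : G), z ∈ 𝒜 g → T (y ⊗ₜ z) =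
      (χ g k : K) • twAct χ X (Coalgebra.comul y) (x ⊗ₜ H.antipode z)) (a : A) :
    T (Coalgebra.comul a) = (a • x) ⊗ₜ 1 := by
  let t : A →ₗ[K] A := scale (DirectSum.Decomposition.isInternal 𝒜) (fun g => χ g k)
  let T₀ : (A ⊗[K] A) ⊗[K] A →ₗ[K] X.carrier ⊗[K] A := TensorProduct.lift
    ((twAct χ X).compl₂ (TensorProduct.mk K X.carrier A x ∘ₗ H.antipode ∘ₗ t))
  have hT₀ : ∀ (u : A ⊗[K] A) (z : A),
      T₀ (u ⊗ₜ z) = twAct χ X u (x ⊗ₜ H.antipode (t z)) := fun _ _ => rfl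
  let W : A →ₗ[K] X.carrier ⊗[K] A := (TensorProduct.mk K X.carrier A).flip 1 ∘ₗ
    (Algebra.lsmul K K X.carrier : A →ₐ[K] Module.End K X.carrier).toLinearMap.flip x
  refine Coalgebra.apply_comul_of_coassoc T T₀ W ?_ ?_ a
  · intro y z
    rw [hT₀]
    induction z using internal_induction (DirectSum.Decomposition.isInternal 𝒜) with
    | zero => simp
    | add z z' hz hz' => simp only [TensorProduct.tmul_add, map_add, hz, hz']
    | hom g z hz =>
      rw [hT y z g hz, scale_of_mem _ _ hz, map_smul, TensorProduct.tmul_smul, map_smul]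
  · intro p q
    -- Here `χ(|y|, k)` comes from moving `y` past `x` in `X ⊗ A`, and it joins `χ(|z|, k)` to form
    -- the factor of `y S(z)`. For `w = Δ(q)` the other antipode axiom applies.
    have key : ∀ w : A ⊗[K] A, T₀ ((TensorProduct.assoc K A A A).symm (p ⊗ₜ w)) =
        (p • x) ⊗ₜ t (LinearMap.mul' K A (H.antipode.lTensor A w)) := by
      intro w
      induction w using TensorProduct.induction_on with
      | zero => simp
      | add x y hx hy => simp only [TensorProduct.tmul_add, map_add, hx, hy]
      | tmul y z =>
        rw [TensorProduct.assoc_symm_tmul, hT₀, LinearMap.lTensor_tmul, LinearMap.mul'_apply]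
        induction y using internal_induction (DirectSum.Decomposition.isInternal 𝒜) with
        | zero => simp
        | add y y' hy hy' =>
          simp only [TensorProduct.tmul_add, map_add, add_mul, LinearMap.add_apply, hy, hy']
        | hom h y hy =>
          induction z using internal_induction (DirectSum.Decomposition.isInternal 𝒜) with
          | zero => simp
          | add z z' hz hz' => simp only [TensorProduct.tmul_add, map_add, mul_add, hz, hz']
          | hom g z hz =>
            rw [twAct_tmul χ X hy hx, scale_of_mem _ _ hz,
              scale_of_mem _ _ (SetLike.GradedMul.mul_mem hy (H.antipode_mem hz))]
            simp only [mul_smul_comm, map_smul, TensorProduct.tmul_smul, smul_smul,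
              χ.map_add_left, Units.val_mul]
    rw [key, H.mul_lTensor_comul q, scale_algebraMap, Algebra.algebraMap_eq_smul_one,
      TensorProduct.tmul_smul]
    rfl

/-! ### The adjunction between induction and the adjoint module -/

/-- The extension of a graded map `X ⟶ ^{ad}N` to `X ⊗ A`. -/
noncomputable def indLiftLin {X : GrMod 𝒜} {N : GrMod (envGr 𝒜)} (f : X ⟶ H.ad N) :
    X.carrier ⊗[K] A →ₗ[K] N.carrier :=
  TensorProduct.lift ((biAct N 1).flip ∘ₗ ((lin f).restrictScalars K : X.carrier →ₗ[K] N.carrier))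

theorem indLiftLin_tmul {X : GrMod 𝒜} {N : GrMod (envGr 𝒜)} (f : X ⟶ H.ad N) (x : X.carrier)
    (b : A) : H.indLiftLin f (x ⊗ₜ b) = biAct N 1 b (lin f x : N.carrier) := rfl

/-- Since `f` is linear for the adjoint action and preserves degrees, the left side is `∑ χ(|a₂|,
|f(x)|) (a₁ · f(x)).a₂b`, to which `sum_biAct_adAct` applies. This is the left linearity of the
extended map. -/
theorem indLiftLin_twAct {X : GrMod 𝒜} {N : GrMod (envGr 𝒜)} (f : X ⟶ H.ad N) (x : X.carrier)
    (a b : A) : H.indLiftLin f (twAct χ X (Coalgebra.comul a) (x ⊗ₜ b)) =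
      biAct N a b (lin f x : N.carrier) := by
  induction x using internal_induction X.internal with
  | zero => simp only [TensorProduct.zero_tmul, map_zero]; exact (map_zero (biAct N a b)).symm
  | add x y hx hy =>
    simp only [TensorProduct.add_tmul, map_add, hx, hy]
    exact (map_add (biAct N a b) _ _).symm
  | hom k x hx =>
    refine H.sum_biAct_adAct N (lin_mem f hx) b
      (H.indLiftLin f ∘ₗ (twAct χ X).flip (x ⊗ₜ b)) (fun y z g hz => ?_) a
    rw [LinearMap.comp_apply, LinearMap.flip_apply, twAct_tmul χ X hz hx, map_smul,
      indLiftLin_tmul, map_smul]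
    rfl

theorem indLiftLin_mem {X : GrMod 𝒜} {N : GrMod (envGr 𝒜)} (f : X ⟶ H.ad N) {g : G}
    {v : X.carrier ⊗[K] A} (hv : v ∈ tensorGr X.gr 𝒜 g) : H.indLiftLin f v ∈ N.gr g := by
  induction hv using Submodule.span_induction with
  | zero => rw [map_zero]; exact zero_mem _
  | add x y _ _ hx hy => rw [map_add]; exact add_mem hx hy
  | smul c x _ hx => rw [map_smul]; exact Submodule.smul_mem _ c hx
  | mem v hv =>
    obtain ⟨k, l, rfl, x, hx, b, hb, rfl⟩ := hv
    rw [indLiftLin_tmul]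
    have := biAct_mem N (SetLike.GradedOne.one_mem (A := 𝒜)) hb (lin_mem f hx)
    rwa [zero_add, add_comm] at this

/-- The extension of a graded map `X ⟶ ^{ad}N` to a map of graded bimodules `X ⊗ A ⟶ N`. -/
noncomputable def indLift {X : GrMod 𝒜} {N : GrMod (envGr 𝒜)} (f : X ⟶ H.ad N) : H.ind X ⟶ N :=
  mkHom (M := H.ind X) (N := N)
    (bilinMk (N := H.ind X) (P := N) (H.indLiftLin f) fun a b =>
      LinearMap.congr_fun (f := H.indLiftLin f ∘ₗ
          (biAct (H.ind X) a b : X.carrier ⊗[K] A →ₗ[K] X.carrier ⊗[K] A))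
        (g := biAct N a b ∘ₗ H.indLiftLin f) <| TensorProduct.ext' fun x c => by
        refine (congrArg (H.indLiftLin f) (H.ind_smul X a b x c)).trans ?_
        refine (H.indLiftLin_twAct f x a (c * b)).trans ?_
        refine Eq.trans ?_ (congrArg (biAct N a b) (H.indLiftLin_tmul f x c)).symm
        exact ((biAct_biAct N a b 1 c _).trans
          (congrArg (fun d => biAct N d (c * b) _) (mul_one a))).symm)
    (fun _ _ hv => H.indLiftLin_mem f hv)

/-- The elements `x ⊗ 1` generate `X ⊗ A` under the right action, because `x ⊗ b = (x ⊗ 1).b`. -/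
theorem ind_hom_ext {X : GrMod 𝒜} {N : GrMod (envGr 𝒜)} {φ ψ : H.ind X ⟶ N}
    (h : ∀ x : X.carrier, lin φ (x ⊗ₜ[K] (1 : A) : X.carrier ⊗[K] A) =
      lin ψ (x ⊗ₜ[K] (1 : A) : X.carrier ⊗[K] A)) : φ = ψ := by
  ext v
  induction v using TensorProduct.induction_on with
  | zero => exact (map_zero (lin φ)).trans (map_zero (lin ψ)).symm
  | add x y hx hy => exact (map_add (lin φ) x y).trans ((congrArg₂ _ hx hy).trans
      (map_add (lin ψ) x y).symm)
  | tmul x b =>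
    have e : (x ⊗ₜ[K] b : X.carrier ⊗[K] A) =
        ((1 : A) ⊗ₜ[K] MulOpposite.op b) •
          (show (H.ind X).carrier from (x ⊗ₜ[K] (1 : A) : X.carrier ⊗[K] A)) := by
      rw [ind_smul, H.comul_one, twAct_one, one_mul]
    rw [e]
    exact (map_smul (lin φ) _ _).trans ((congrArg _ (h x)).trans (map_smul (lin ψ) _ _).symm)

/-- The restriction of a map of graded bimodules `X ⊗ A ⟶ N` along `x ↦ x ⊗ 1`. -/
noncomputable def indRestrict {X : GrMod 𝒜} {N : GrMod (envGr 𝒜)} (φ : H.ind X ⟶ N) :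
    X ⟶ H.ad N :=
  let r : X.carrier →ₗ[K] N.carrier :=
    ((lin φ).restrictScalars K : X.carrier ⊗[K] A →ₗ[K] N.carrier) ∘ₗ
      (TensorProduct.mk K X.carrier A).flip 1
  have hr : ∀ g, ∀ x ∈ X.gr g, r x ∈ N.gr g := fun g x hx => by
    have h1 : (x ⊗ₜ[K] (1 : A) : X.carrier ⊗[K] A) ∈ tensorGr X.gr 𝒜 (g + 0) :=
      tmul_mem_tensorGr hx SetLike.GradedOne.one_mem
    rw [add_zero] at h1
    exact lin_mem φ h1
  mkHom (M := X) (N := H.ad N)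
    { r with
      map_smul' := fun a x => by
        change r (a • x) = H.adAct N (Coalgebra.comul a) (r x)
        induction x using internal_induction X.internal with
        | zero => simp
        | add x y hx hy => simp only [smul_add, map_add, hx, hy]
        | hom k x hx =>
          -- For `x` of degree `k`, `a x ⊗ 1` is written as `∑ χ(|a₂|, k) a₁.(x ⊗ 1).S(a₂)`, the
          -- value of `T` at `Δ(a)`. Applying the bimodule map `φ` termwise (`key`) turns this sum
          -- into the adjoint action of `a` on `φ(x ⊗ 1)`.
          let t : A →ₗ[K] A := scale (DirectSum.Decomposition.isInternal 𝒜) (fun g => χ g k)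
          let T : A ⊗[K] A →ₗ[K] X.carrier ⊗[K] A := TensorProduct.lift
            (((twAct χ X ∘ₗ Coalgebra.comul)).compl₂
              (TensorProduct.mk K X.carrier A x ∘ₗ H.antipode ∘ₗ t))
          have hT : ∀ y z, T (y ⊗ₜ z) =
            twAct χ X (Coalgebra.comul y) (x ⊗ₜ H.antipode (t z)) := fun _ _ => rfl
          have e := H.sum_twAct_antipode X hx T (fun y z g hz => by
            rw [hT, scale_of_mem _ _ hz, map_smul, TensorProduct.tmul_smul, map_smul]) a
          have key : ((lin φ).restrictScalars K : X.carrier ⊗[K] A →ₗ[K] N.carrier) ∘ₗ T =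
              (H.adAct N).flip (r x) := by
            refine TensorProduct.ext (LinearMap.ext fun y => ?_)
            refine hom_ext_of_internal (DirectSum.Decomposition.isInternal 𝒜) fun g z hz => ?_
            change lin φ (T (y ⊗ₜ z)) = H.adAct N (y ⊗ₜ z) (r x)
            rw [H.adAct_tmul_biAct N hz (hr _ x hx), hT, scale_of_mem _ _ hz, map_smul,
              TensorProduct.tmul_smul, map_smul]
            refine (LinearMap.map_smul_of_tower (lin φ) (χ g k : K) _).trans ?_
            congr 1
            have e2 := H.ind_smul X y (H.antipode z) x 1
            rw [one_mul] at e2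
            rw [← e2]
            exact map_smul (lin φ) _ _
          refine Eq.trans ?_ (LinearMap.congr_fun key (Coalgebra.comul a))
          exact congrArg (lin φ) e.symm }
    hr

theorem indLift_indRestrict {X : GrMod 𝒜} {N : GrMod (envGr 𝒜)} (φ : H.ind X ⟶ N) :
    H.indLift (H.indRestrict φ) = φ :=
  H.ind_hom_ext fun _ => biAct_one N _

theorem indRestrict_indLift {X : GrMod 𝒜} {N : GrMod (envGr 𝒜)} (f : X ⟶ H.ad N) :
    H.indRestrict (H.indLift f) = f := by
  apply hom_ext
  exact fun x => biAct_one N _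

/-- A graded map preserves `|m|`, so the factor `χ(|b|, |m|)` is the same before and after `f`. This
is why `ad` is functorial on degree-preserving maps. -/
theorem lin_adAct {M N : GrMod (envGr 𝒜)} (f : M ⟶ N) (z : A ⊗[K] A) (m : M.carrier) :
    lin f (H.adAct M z m) = H.adAct N z (lin f m) := by
  induction z using TensorProduct.induction_on with
  | zero => simp
  | add x y hx hy => simp only [map_add, LinearMap.add_apply, hx, hy]
  | tmul a b =>
  induction b using internal_induction (DirectSum.Decomposition.isInternal 𝒜) with
  | zero => simp
  | add x y hx hy => simp only [TensorProduct.tmul_add, map_add, LinearMap.add_apply, hx, hy]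
  | hom g b hb =>
  induction m using internal_induction M.internal with
  | zero => simp
  | add x y hx hy => simp only [map_add, hx, hy]
  | hom k m hm =>
    rw [H.adAct_tmul M hb hm, H.adAct_tmul N hb (lin_mem f hm)]
    refine (LinearMap.map_smul_of_tower (lin f) (χ g k : K) _).trans ?_
    rw [map_smul]

/-! ### The adjoint functor is exact and preserves injectives -/

/-- The adjoint module as a functor. -/
noncomputable def adFunctor : GrMod (envGr 𝒜) ⥤ GrMod 𝒜 where
  obj N := H.ad N
  map {M N} f := mkHom (M := H.ad M) (N := H.ad N)
    { toFun := fun m => (lin f : M.carrier → N.carrier) m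
      map_add' := map_add (lin f)
      map_smul' := fun a m => H.lin_adAct f (Coalgebra.comul a) m }
    (fun _ _ hm => lin_mem (M := M) (N := N) f hm)
  map_id _ := rfl
  map_comp _ _ := rfl

instance : H.adFunctor.Additive where
  map_add := rfl

instance : H.adFunctor.PreservesHomology :=
  preservesHomology_of_bijective H.adFunctor (fun M => AddEquiv.refl M.carrier)
    (fun _ _ => rfl)

/-- The map `X ⊗ A ⟶ Y ⊗ A` induced by a map `X ⟶ Y`. -/
noncomputable def indMap {X Y : GrMod 𝒜} (i : X ⟶ Y) : H.ind X ⟶ H.ind Y :=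
  H.indLift (i ≫ H.indRestrict (𝟙 (H.ind Y)))

/-- `indMap` comes out of the adjunction; recognizing it as `i ⊗ id_A` makes flatness applicable. -/
theorem lin_indMap {X Y : GrMod 𝒜} (i : X ⟶ Y) (v : X.carrier ⊗[K] A) :
    lin (H.indMap i) v = (((lin i).restrictScalars K).rTensor A v : Y.carrier ⊗[K] A) := by
  refine LinearMap.congr_fun (f := ((lin (H.indMap i)).restrictScalars K :
    X.carrier ⊗[K] A →ₗ[K] Y.carrier ⊗[K] A)) (TensorProduct.ext' fun x b => ?_) v
  refine (H.ind_smul Y 1 b (lin i x) 1).trans ?_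
  rw [H.comul_one, twAct_one, one_mul]
  rfl

/-- Every vector space is flat, and monomorphisms of graded modules are the injective ones. -/
theorem mono_indMap {X Y : GrMod 𝒜} (i : X ⟶ Y) [Mono i] : Mono (H.indMap i) := by
  refine mono_of_injective _ fun v w hvw => ?_
  have hi := injective_of_mono i
  refine Module.Flat.rTensor_preserves_injective_linearMap (M := A)
    ((lin i).restrictScalars K) hi ?_
  exact (H.lin_indMap i v).symm.trans (hvw.trans (H.lin_indMap i w))

/-- A right adjoint of a functor preserving monomorphisms preserves injectives: `g : X ⟶ ^{ad}J` is
transposed to `X ⊗ A ⟶ J`, extended along `i ⊗ id_A`, and transposed back. -/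
instance : H.adFunctor.PreservesInjectiveObjects where
  injective_obj {J} hJ := ⟨fun {X Y} g i hi => by
    have := H.mono_indMap i
    refine ⟨H.indRestrict (Injective.factorThru (H.indLift (N := J) g) (H.indMap i)), ?_⟩
    have e : H.indRestrict (N := J) (H.indMap i ≫
        Injective.factorThru (H.indLift (N := J) g) (H.indMap i)) = g := by
      rw [Injective.comp_factorThru]
      exact H.indRestrict_indLift (N := J) g
    refine Eq.trans ?_ e
    apply hom_ext
    intro x
    -- Naturality of the transposition in `X`: `i ⊗ id_A` sends `x ⊗ 1` to `i(x) ⊗ 1`.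
    refine congrArg (lin (Injective.factorThru (H.indLift (N := J) g) (H.indMap i))) ?_
    exact (H.lin_indMap i (x ⊗ₜ 1)).symm⟩

/-- `Hom_{A^e-gr}(X ⊗ A, N) ≅ Hom_{A-gr}(X, ^{ad}N)`. -/
noncomputable def indEquiv (X : GrMod 𝒜) (N : GrMod (envGr 𝒜)) :
    (H.ind X ⟶ N) ≃ₗ[K] (X ⟶ H.ad N) where
  toFun := H.indRestrict
  invFun := H.indLift
  map_add' _ _ := rfl
  map_smul' _ _ := rfl
  left_inv := H.indLift_indRestrict
  right_inv := H.indRestrict_indLift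

/-- `Hom_{A^e-gr}(X ⊗ A, -) ≅ Hom_{A-gr}(X, ^{ad}(-))`. -/
noncomputable def coyonedaIndIso (X : GrMod 𝒜) :
    (linearCoyoneda K (GrMod (envGr 𝒜))).obj (Opposite.op (H.ind X)) ≅
      H.adFunctor ⋙ (linearCoyoneda K (GrMod 𝒜)).obj (Opposite.op X) :=
  NatIso.ofComponents (fun N => (H.indEquiv X N).toModuleIso) (fun _ => rfl)

/-! ### The regular bimodule as the induced trivial module -/

theorem one_mem_trivialModule : (1 : K) ∈ H.trivialModule.gr 0 := by
  change (1 : K) ∈ (if (0 : G) = 0 then (⊤ : Submodule K K) else ⊥)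
  rw [if_pos rfl]
  trivial

/-- The element `1 ∈ 𝕂` has degree `0`, so the color factor is `1`, and the first leg acts through
`ε`. At `z = Δ(a)` the counit axiom turns the result into `1 ⊗ a d`, so `b ↦ 1 ⊗ b` is left linear.
-/
theorem twAct_trivialModule (z : A ⊗[K] A) (d : A) :
    twAct χ H.trivialModule z ((1 : K) ⊗ₜ d) =
      ((1 : K) ⊗ₜ[K] (TensorProduct.lid K A ((Coalgebra.counit (R := K)).rTensor A z) * d) :
        K ⊗[K] A) := by
  induction z using TensorProduct.induction_on with
  | zero =>
    rw [map_zero, map_zero, map_zero, zero_mul, TensorProduct.tmul_zero]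
    rfl
  | add x y hx hy =>
    rw [map_add, map_add, map_add, add_mul, TensorProduct.tmul_add, ← hx, ← hy]
    rfl
  | tmul a b =>
  induction b using internal_induction (DirectSum.Decomposition.isInternal 𝒜) with
  | zero =>
    rw [TensorProduct.tmul_zero, map_zero, map_zero, map_zero, zero_mul, TensorProduct.tmul_zero]
    rfl
  | add x y hx hy =>
    rw [TensorProduct.tmul_add, map_add, map_add, map_add, add_mul, TensorProduct.tmul_add,
      ← hx, ← hy]
    rfl
  | hom g b hb =>
    refine (twAct_tmul χ H.trivialModule hb H.one_mem_trivialModule a d).trans ?_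
    rw [χ.zero_right, Units.val_one, one_smul, LinearMap.rTensor_tmul, TensorProduct.lid_tmul,
      smul_mul_assoc, ← TensorProduct.smul_tmul]
    rfl

/-- The map `b ↦ 1 ⊗ b` from `A` to `𝕂 ⊗ A`. -/
noncomputable def regularToInd : regular 𝒜 ⟶ H.ind H.trivialModule :=
  mkHom (M := regular 𝒜) (N := H.ind H.trivialModule)
    (bilinMk (N := regular 𝒜) (P := H.ind H.trivialModule)
      (TensorProduct.mk K K A 1 : A →ₗ[K] K ⊗[K] A) fun a c (b : A) => by
      refine (congrArg (TensorProduct.mk K K A 1) (regular_smul 𝒜 a c b)).trans ?_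
      refine Eq.trans ?_ (H.ind_smul H.trivialModule a c (1 : K) b).symm
      refine Eq.trans ?_ (H.twAct_trivialModule (Coalgebra.comul a) (b * c)).symm
      rw [Coalgebra.rTensor_counit_comul, TensorProduct.lid_tmul, one_smul, mul_assoc]
      rfl)
    (fun g b hb => by
      have := tmul_mem_tensorGr (ℳ := H.trivialModule.gr) (𝒩 := 𝒜) H.one_mem_trivialModule hb
      rwa [zero_add] at this)

/-- The underlying map is the inverse of `𝕂 ⊗ A ≅ A`, hence bijective. In an abelian category, mono
and epi together give an isomorphism. -/
theorem isIso_regularToInd : IsIso H.regularToInd := by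
  have : Mono H.regularToInd := mono_of_injective _ fun (b b' : A) hb => by
    have e : TensorProduct.lid K A ((1 : K) ⊗ₜ b) = TensorProduct.lid K A ((1 : K) ⊗ₜ b') :=
      congrArg (TensorProduct.lid K A) hb
    rwa [TensorProduct.lid_tmul, TensorProduct.lid_tmul, one_smul, one_smul] at e
  have : Epi H.regularToInd := epi_of_surjective _ fun v => by
    refine ⟨TensorProduct.lid K A v, ?_⟩
    exact (TensorProduct.lid K A).symm_apply_apply v
  exact isIso_of_mono_of_epi _

/-! ### The comparison isomorphisms -/

/-- `HOM_{A^e}(A, M)_h ≅ Hom_{A-gr}(𝕂, ^{ad}(M[h]))`, naturally in `M`. -/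
noncomputable def homDegRegularIso (h : G) :
    homDegFunctor h (regular 𝒜) ≅ (shiftFunctor (envGr 𝒜) h ⋙ H.adFunctor) ⋙
      (linearCoyoneda K (GrMod 𝒜)).obj (Opposite.op H.trivialModule) :=
  haveI := H.isIso_regularToInd
  homDegFunctorIso h (regular 𝒜) ≪≫
    Functor.isoWhiskerLeft (shiftFunctor (envGr 𝒜) h)
      ((linearCoyoneda K (GrMod (envGr 𝒜))).mapIso (asIso H.regularToInd).symm.op ≪≫
        H.coyonedaIndIso H.trivialModule)

/-- `HH^n(A, M)_h ≅ Ext^n_{A-gr}(𝕂, ^{ad}(M[h]))`. -/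
noncomputable def hochschildDegIso (n : ℕ) (h : G) (M : GrMod (envGr 𝒜)) :
    hochschildDeg 𝒜 n h M ≅ grExt n H.trivialModule (H.ad (shift h M)) :=
  haveI : (shiftFunctor (envGr 𝒜) h ⋙ H.adFunctor).PreservesHomology :=
    preservesHomology_of_bijective _ (fun M => AddEquiv.refl M.carrier) (fun _ _ => rfl)
  (shiftFunctor (envGr 𝒜) h ⋙ H.adFunctor).rightDerivedObjIso (H.homDegRegularIso h) n M

theorem adAct_shift {h : G} (hχ : ∀ g, χ g h = 1) (M : GrMod (envGr 𝒜)) (z : A ⊗[K] A)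
    (m : M.carrier) : H.adAct (shift h M) z m = H.adAct M z m := by
  refine LinearMap.congr_fun (f := (H.adAct (shift h M) z : M.carrier →ₗ[K] M.carrier)) ?_ m
  refine LinearMap.congr_fun (f := (H.adAct (shift h M) : _ →ₗ[K] M.carrier →ₗ[K] M.carrier)) ?_ z
  refine TensorProduct.ext (LinearMap.ext fun a => ?_)
  refine hom_ext_of_internal (DirectSum.Decomposition.isInternal 𝒜) fun g b hb => ?_
  refine hom_ext_of_internal M.internal fun k m hm => ?_
  -- An element of degree `k` in `M` has degree `k - h` in `M[h]`, so the two actions differ by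
  -- `χ(g, k)` against `χ(g, k - h)`. These are equal exactly because `χ(g, h) = 1`.
  have hm' : m ∈ (shift h M).gr (-h + k) := by
    change m ∈ M.gr (h + (-h + k))
    rwa [add_neg_cancel_left]
  refine (H.adAct_tmul (shift h M) hb hm' a).trans (Eq.trans ?_ (H.adAct_tmul M hb hm a).symm)
  have e : χ g k = χ g (-h + k) := by
    conv_lhs => rw [← add_neg_cancel_left h k, χ.map_add_right, hχ, one_mul]
  rw [e]
  rfl

/-- If `χ(g, h) = 1` for all `g`, then `(^{ad}M)[h] ≅ ^{ad}(M[h])`. -/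
noncomputable def shiftAdIso {h : G} (hχ : ∀ g, χ g h = 1) (M : GrMod (envGr 𝒜)) :
    shift h (H.ad M) ≅ H.ad (shift h M) where
  hom := mkHom (M := shift h (H.ad M)) (N := H.ad (shift h M))
    { toFun := fun m => m
      map_add' := fun _ _ => rfl
      map_smul' := fun a m => (H.adAct_shift hχ M (Coalgebra.comul a) m).symm }
    (fun _ _ hm => hm)
  inv := mkHom (M := H.ad (shift h M)) (N := shift h (H.ad M))
    { toFun := fun m => m
      map_add' := fun _ _ => rfl
      map_smul' := fun a m => H.adAct_shift hχ M (Coalgebra.comul a) m }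
    (fun _ _ hm => hm)
  hom_inv_id := rfl
  inv_hom_id := rfl

end ColorHopf.ColorHopfAlgebra

theorem corollary1 {K : Type u} [Field K] [CharZero K]
    {G : Type u} [AddCommGroup G] [DecidableEq G] (χ : Bicharacter K G)
    {A : Type u} [Ring A] [Algebra K A] (𝒜 : G → Submodule K A) [GradedAlgebra 𝒜]
    [Coalgebra K A] (H : ColorHopfAlgebra χ 𝒜) (M : GrMod (envGr 𝒜)) (h : G) (n : ℕ) :
    Nonempty (hochschildDeg 𝒜 n h M ≅
      GrMod.grExt n H.trivialModule (H.ad (GrMod.shift h M))) ∧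
    Nonempty (GrMod.grExt n H.trivialModule (H.ad (GrMod.shift h M)) ≅
      GrMod.extDeg n h H.trivialModule (GrMod.shift (-h) (H.ad (GrMod.shift h M)))) ∧
    ((∀ g : G, χ g h = 1) →
      Nonempty (GrMod.grExt n H.trivialModule (H.ad (GrMod.shift h M)) ≅
        GrMod.extDeg n h H.trivialModule (H.ad M))) :=
  ⟨⟨H.hochschildDegIso n h M⟩,
    -- The shift by `h` implicit in `EXT(-, -)_h` cancels the shift by `-h`. The adjoint action,
    -- formed before the second shift, keeps the degrees of `M[h]`.
    ⟨GrMod.grExtIsoOfIso n _ (GrMod.shiftNegShift h _).symm ≪≫ (GrMod.extDegIso n h _ _).symm⟩,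
    fun hχ => ⟨GrMod.grExtIsoOfIso n _ (H.shiftAdIso hχ M).symm ≪≫
      (GrMod.extDegIso n h _ _).symm⟩⟩
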